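/- Let $X$ be a compact geodesic metric space (any two points $x,y$ are joined by an isometrically embedded copy of $[0,d(x,y)]$) which is semi-locally simply connected (every point $x$ has a neighbourhood $U$ such that every loop in $U$ based at $x$ is null-homotopic in $X$), and let $\bullet\in X$. For $r>0$ let $\mathrm{Rips}(X,r)$ be the open Rips complex, with vertex set $X$ and with the non-empty finite subsets of $X$ of diameter $<r$ as simplices. The open-Rips $\pi_1$-persistence of $X$ consists of the groups $\pi_1(\mathrm{Rips}(X,r),\bullet)$, $r>0$, together with the homomorphisms $i_{p,q}\colon\pi_1(\mathrm{Rips}(X,p),\bullet)\to\pi_1(\mathrm{Rips}(X,q),\bullet)$, $p<q$, induced by inclusion. A number $p>0$ is a critical value if $i_{p-\varepsilon,p}$ is not an isomorphism for all small enough $\varepsilon>0$, or if $i_{p,p+\varepsilon}$ is not an isomorphism for all $\varepsilon>0$. A geodesic circle of length $l>0$ is an isometric embedding into $X$ of the circle of circumference $l$ with its arc-length metric. A geodesic lasso is a loop $\alpha*\beta*\alpha^-$ based at $\bullet$, where $\alpha$ is a path starting at $\bullet$ that is a local geodesic (constant speed, all sufficiently short pieces distance-minimizing; constant paths are allowed)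 and $\beta$ is a geodesic circle based at the endpoint of $\alpha$. Then: 1. The open-Rips $\pi_1$-persistence of $X$ has only finitely many critical values. 2. $\pi_1(X,\bullet)$ is generated by (the classes of) finitely many geodesic lassos. 3. For each critical value $q$ there is at least one geodesic circle of length $3q$, and the geodesic circles of length $3q$ represent only finitely many free homotopy classes. 4. The geodesic circles in $X$, of all lengths, represent only finitely many free homotopy classes. -/

import Mathlib

open Topology

/-- A geodesic space: any two points `x`, `y` are joined by an isometric copy of `[0, d(x, y)]`. -/
def IsGeodesicSpace (X : Type*) [MetricSpace X] : Prop :=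
  ∀ x y : X, ∃ γ : ℝ → X, γ 0 = x ∧ γ (dist x y) = y ∧
    ∀ s ∈ Set.Icc (0 : ℝ) (dist x y), ∀ t ∈ Set.Icc (0 : ℝ) (dist x y),
      dist (γ s) (γ t) = |s - t|

/-- Semi-locally simply connected: `X` is path-connected and every point `x` has a neighbourhood
`U` such that every loop in `U` based at `x` is null-homotopic in `X`. -/
def IsSLSC (X : Type*) [TopologicalSpace X] : Prop :=
  PathConnectedSpace X ∧
    ∀ x : X, ∃ U ∈ 𝓝 x, ∀ γ : Path x x, Set.range γ ⊆ U → γ.Homotopic (Path.refl x)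

/-! ### Geometric realization of an abstract simplicial complex -/

/-- A point of the geometric realization `|K|`: finitely supported barycentric coordinates which
are non-negative, sum to `1`, and whose support is a simplex of `K`. -/
@[ext]
structure GeomRealization {V : Type*} (K : AbstractSimplicialComplex V) where
  coord : V →₀ ℝ
  nonneg : ∀ v, 0 ≤ coord v
  sum_eq_one : ∑ v ∈ coord.support, coord v = 1
  support_mem : coord.support ∈ K.faces

namespace GeomRealization

variable {V : Type*}

/-- The characteristic map of a simplex `σ` of `K`: the standard simplex with vertex set `σ` is
mapped to `|K|` by extending barycentric coordinates by zero. -/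
noncomputable def simplexMap (K : AbstractSimplicialComplex V) (σ : K.faces)
    (p : stdSimplex ℝ σ.1) : GeomRealization K where
  coord := (Finsupp.equivFunOnFinite.symm p.1).embDomain
    (Function.Embedding.subtype (· ∈ σ.1))
  nonneg v := by
    by_cases hv : v ∈ Set.range (Function.Embedding.subtype (· ∈ σ.1))
    · obtain ⟨w, rfl⟩ := hv
      rw [Finsupp.embDomain_apply_self]
      exact p.2.1 w
    · rw [Finsupp.embDomain_of_notMem_range _ _ _ hv]
  sum_eq_one := by
    rw [Finsupp.support_embDomain, Finset.sum_map]
    simp only [Finsupp.embDomain_apply_self]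
    rw [← p.2.2]
    refine Finset.sum_subset (Finset.subset_univ _) fun w _ hw => ?_
    exact Finsupp.notMem_support_iff.mp hw
  support_mem := by
    refine (K.isRelLowerSet_faces σ.2).2 ?_ ?_
    · intro v hv
      rw [Finsupp.support_embDomain, Finset.mem_map] at hv
      obtain ⟨w, _, rfl⟩ := hv
      exact w.2
    · rw [Finsupp.support_embDomain, Finset.map_nonempty, Finset.nonempty_iff_ne_empty]
      intro h
      have h0 : ∀ w : σ.1, p.1 w = 0 := fun w => by
        have hw : w ∉ (Finsupp.equivFunOnFinite.symm
          p.1).support := by simp [h]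
        exact Finsupp.notMem_support_iff.mp hw
      have h1 := p.2.2
      simp [h0] at h1

/-- The weak topology: a set is open iff its preimage in every (closed) simplex is open. -/
noncomputable instance (K : AbstractSimplicialComplex V) : TopologicalSpace (GeomRealization K) :=
  ⨆ σ : K.faces, TopologicalSpace.coinduced (simplexMap K σ) inferInstance

/-- The vertex `v`, as a point of `|K|`. -/
noncomputable def vertex (K : AbstractSimplicialComplex V) (v : V) : GeomRealization K where
  coord := Finsupp.single v 1
  nonneg w := by
    classical
    rw [Finsupp.single_apply]
    split_ifs <;> norm_num
  sum_eq_one := by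
    rw [Finsupp.support_single v (one_ne_zero : (1 : ℝ) ≠ 0)]
    simp
  support_mem := by
    rw [Finsupp.support_single v (one_ne_zero : (1 : ℝ) ≠ 0)]
    exact K.singleton_mem v

/-- The map `|K| → |L|` induced by the inclusion of a subcomplex `K` of `L`
(the identity on vertices). -/
def inclusion {K L : AbstractSimplicialComplex V} (h : K.faces ⊆ L.faces) :
    C(GeomRealization K, GeomRealization L) where
  toFun p := ⟨p.coord, p.nonneg, p.sum_eq_one, h p.support_mem⟩
  continuous_toFun := by
    refine continuous_iSup_dom.2 fun σ => continuous_coinduced_dom.2 ?_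
    exact continuous_iSup_rng (i := (⟨σ.1, h σ.2⟩ : L.faces)) continuous_coinduced_rng

theorem inclusion_vertex {K L : AbstractSimplicialComplex V} (h : K.faces ⊆ L.faces) (v : V) :
    inclusion h (vertex K v) = vertex L v := rfl

end GeomRealization

/-! ### The `π₁`-persistence of the open Rips filtration -/

/-- The open Rips complex: vertices are the points of `X`, simplices are the non-empty finite
subsets of diameter `< r`. -/
def ripsComplex (X : Type*) [MetricSpace X] (r : ℝ) (hr : 0 < r) : AbstractSimplicialComplex X where
  faces := {σ | σ.Nonempty ∧ Metric.diam (σ : Set X) < r}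
  isRelLowerSet_faces := by
    intro σ hσ
    refine ⟨hσ.1, fun τ hτσ hτ => ⟨hτ, lt_of_le_of_lt ?_ hσ.2⟩⟩
    exact Metric.diam_mono (by exact_mod_cast hτσ) σ.finite_toSet.isBounded
  singleton_mem v := by simpa using hr

theorem ripsComplex_faces_mono (X : Type*) [MetricSpace X] {p q : ℝ} (hp : 0 < p) (hq : 0 < q)
    (hpq : p ≤ q) : (ripsComplex X p hp).faces ⊆ (ripsComplex X q hq).faces :=
  fun _ hσ => ⟨hσ.1, lt_of_lt_of_le hσ.2 hpq⟩

/-- The bonding homomorphism `π₁(Rips(X, p), x₀) → π₁(Rips(X, q), x₀)`, for `0 < p ≤ q`. -/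
noncomputable def ripsPi1Map {X : Type*} [MetricSpace X] (x₀ : X) (p q : ℝ) (hp : 0 < p)
    (hq : 0 < q) (hpq : p ≤ q) :
    FundamentalGroup (GeomRealization (ripsComplex X p hp))
        (GeomRealization.vertex (ripsComplex X p hp) x₀) →*
      FundamentalGroup (GeomRealization (ripsComplex X q hq))
        (GeomRealization.vertex (ripsComplex X q hq) x₀) :=
  FundamentalGroup.mapOfEq
    (GeomRealization.inclusion (ripsComplex_faces_mono X hp hq hpq))
    (GeomRealization.inclusion_vertex (ripsComplex_faces_mono X hp hq hpq) x₀)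

/-- `p > 0` is a left critical value: for all small enough `ε > 0` the bonding map from `p - ε`
to `p` is not an isomorphism. -/
def IsLeftCriticalValue {X : Type*} [MetricSpace X] (x₀ : X) (p : ℝ) : Prop :=
  ∃ hp : 0 < p, ∃ ε₀ > 0, ∀ (ε : ℝ) (hε : 0 < ε) (_ : ε < ε₀) (hpε : 0 < p - ε),
    ¬ Function.Bijective (ripsPi1Map x₀ (p - ε) p hpε hp (sub_le_self p hε.le))

/-- `p > 0` is a right critical value: for all `ε > 0` the bonding map from `p` to `p + ε` is not
an isomorphism. -/
def IsRightCriticalValue {X : Type*} [MetricSpace X] (x₀ : X) (p : ℝ) : Prop :=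
  ∃ hp : 0 < p, ∀ (ε : ℝ) (hε : 0 < ε),
    ¬ Function.Bijective
      (ripsPi1Map x₀ p (p + ε) hp (add_pos hp hε) (le_add_of_nonneg_right hε.le))

/-- Critical values of the `π₁`-persistence of `(X, x₀)` via the open Rips filtration. -/
def IsCriticalValue {X : Type*} [MetricSpace X] (x₀ : X) (p : ℝ) : Prop :=
  IsLeftCriticalValue x₀ p ∨ IsRightCriticalValue x₀ p

/-! ### Geodesic circles and geodesic lassos -/

/-- `c` is a geodesic circle of length `l > 0`: an isometric embedding of the circle of
circumference `l` with its arc-length metric. Here `UnitAddCircle = ℝ ⧸ ℤ` carries the arc-length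
metric of circumference `1`, so the circle of circumference `l` is this one rescaled by `l`. -/
def IsGeodesicCircle {X : Type*} [MetricSpace X] (l : ℝ) (c : C(UnitAddCircle, X)) : Prop :=
  0 < l ∧ ∀ s t : UnitAddCircle, dist (c s) (c t) = l * dist s t

/-- Two closed curves are identified when they are freely homotopic. -/
def freeHomotopySetoid (X : Type*) [TopologicalSpace X] : Setoid C(UnitAddCircle, X) :=
  ⟨ContinuousMap.Homotopic, ContinuousMap.Homotopic.equivalence⟩

/-- The free homotopy class of a closed curve. -/
def freeHomotopyClass {X : Type*} [TopologicalSpace X] (c : C(UnitAddCircle, X)) :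
    Quotient (freeHomotopySetoid X) :=
  Quotient.mk (freeHomotopySetoid X) c

/-- A path is a (local) geodesic if it has constant speed `v ≥ 0` and all its sufficiently short
pieces minimize distance. Constant paths are allowed. -/
def IsLocalGeodesic {X : Type*} [MetricSpace X] {x y : X} (α : Path x y) : Prop :=
  ∃ v : ℝ, 0 ≤ v ∧ ∃ δ > 0, ∀ s t : unitInterval, dist s t < δ →
    dist (α s) (α t) = v * dist s t

/-- The loop based at `c 0` obtained by going once around the closed curve `c`. -/
def circleLoop {X : Type*} [TopologicalSpace X] (c : C(UnitAddCircle, X)) : Path (c 0) (c 0) where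
  toFun t := c ((t : ℝ) : UnitAddCircle)
  continuous_toFun :=
    c.continuous.comp ((AddCircle.continuous_mk' (1 : ℝ)).comp continuous_subtype_val)
  source' := by simp
  target' := by simp [AddCircle.coe_period]

/-- The classes in `π₁(X, x₀)` of geodesic lassos `α * β * α⁻`, where `α` is a geodesic path
starting at `x₀` and `β` is a geodesic circle based at the endpoint of `α`. -/
def geodesicLassoClasses {X : Type*} [MetricSpace X] (x₀ : X) : Set (FundamentalGroup X x₀) :=
  {g | ∃ (l : ℝ) (c : C(UnitAddCircle, X)) (α : Path x₀ (c 0)),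
    IsGeodesicCircle l c ∧ IsLocalGeodesic α ∧
      g = FundamentalGroup.fromPath
        (Path.Homotopic.Quotient.mk ((α.trans (circleLoop c)).trans α.symm))}

/-! The engine is a variational principle. Let φ be a functor from the fundamental groupoid of X to
a group. Among the closed curves on which φ is non-trivial there is a shortest one, by
Arzelà–Ascoli, since triviality of φ is unchanged by uniformly small perturbations. It is a geodesic
circle: a chord shorter than both arcs between two of its points would split it into two shorter
loops, both killed by φ, and φ would kill the curve itself
(`IsSmallRadius.exists_isGeodesicCircle`).

Compactness and semi-local simple connectivity give a scale R such that closed curves at uniform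
distance less than R / 2 are freely homotopic. A compact space of uniformly Lipschitz curves
therefore meets finitely many free homotopy classes; this settles the geodesic circles, whose
lengths are bounded by twice the diameter.

For the lassos, φ is taken with values in the quotient of π₁ by the subgroup they generate, which is
normal because a conjugate of a lasso class is again one. No geodesic circle survives in the
quotient, so it is trivial. Finitely many lassos suffice because π₁ is generated by the finitely
many classes of loops of a certain bounded length.

For the persistence, sending paths of length < r to edges of Rips(X, r) defines an action
`ripsTheta` of the fundamental groupoid of X on the group π₁(Rips(X, r)). Loops shorter than 3r act
trivially, being triangles. Bonding maps are always surjective, and the one from p to q is injective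
as soon as loops shorter than 3q act trivially at scale p. A bonding map that is not bijective thus
produces a geodesic circle of length in [3p, 3q) acting non-trivially at scale p. At a right
critical value q such circles converge to one of length 3q. Left critical values do not exist:
infinitely many of the circles below 3q would share one class, yet the shorter ones act trivially at
later scales. Finally, circles attached to distinct critical values are not freely homotopic, since
the larger scale kills only the shorter one; so there are finitely many critical values. -/

/-- Homotopy classes of paths relative to the endpoints. -/
abbrev PathClass {X : Type*} [TopologicalSpace X] (x y : X) := Path.Homotopic.Quotient x y

/-! ### Groupoid calculus of path classes. -/

namespace PathClass

variable {X Y : Type*} [TopologicalSpace X] [TopologicalSpace Y] {x y z w : X}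

theorem symm_trans_trans (p : PathClass y x) (q : PathClass x z) :
    p.symm.trans (p.trans q) = q := by
  rw [← Path.Homotopic.Quotient.trans_assoc]; simp

theorem symm_symm (p : PathClass x y) : p.symm.symm = p := by
  obtain ⟨γ, rfl⟩ := Path.Homotopic.Quotient.mk_surjective p
  simp [← Path.Homotopic.Quotient.mk_symm]

theorem symm_trans_rev (p : PathClass x y) (q : PathClass y z) :
    (p.trans q).symm = q.symm.trans p.symm := by
  obtain ⟨γ, rfl⟩ := Path.Homotopic.Quotient.mk_surjective p
  obtain ⟨δ, rfl⟩ := Path.Homotopic.Quotient.mk_surjective q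
  simp [← Path.Homotopic.Quotient.mk_symm, ← Path.Homotopic.Quotient.mk_trans, Path.trans_symm]

theorem map_trans (f : C(X, Y)) (p : PathClass x y) (q : PathClass y z) :
    (p.trans q).map f = (p.map f).trans (q.map f) := by
  obtain ⟨γ, rfl⟩ := Path.Homotopic.Quotient.mk_surjective p
  obtain ⟨δ, rfl⟩ := Path.Homotopic.Quotient.mk_surjective q
  simp only [← Path.Homotopic.Quotient.mk_map, ← Path.Homotopic.Quotient.mk_trans]
  rw [Path.map_trans]

end PathClass

/-! ### Group-valued functors on the fundamental groupoid. -/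

/-- A functor from the fundamental groupoid of `Y` to the group `G`
(composition of paths being written from right to left, as in `FundamentalGroup`). -/
structure PathHom (Y : Type*) [TopologicalSpace Y] (G : Type*) [Group G] where
  toFun : ∀ {x y : Y}, PathClass x y → G
  map_trans' : ∀ {x y z : Y} (p : PathClass x y) (q : PathClass y z),
    toFun (p.trans q) = toFun q * toFun p

namespace PathHom

variable {X Y : Type*} [TopologicalSpace X] [TopologicalSpace Y]
  {G H : Type*} [Group G] [Group H]

instance : CoeFun (PathHom Y G) (fun _ => ∀ {x y : Y}, PathClass x y → G) := ⟨toFun⟩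

variable (φ : PathHom Y G) {x y z : Y}

theorem map_trans (p : PathClass x y) (q : PathClass y z) : φ (p.trans q) = φ q * φ p :=
  φ.map_trans' p q

@[simp] theorem map_refl (x : Y) : φ (Path.Homotopic.Quotient.refl x) = 1 := by
  have h := φ.map_trans (.refl x) (.refl x)
  rw [Path.Homotopic.Quotient.trans_refl] at h
  exact left_eq_mul.mp h

@[simp] theorem map_symm (p : PathClass x y) : φ p.symm = (φ p)⁻¹ := by
  rw [eq_inv_iff_mul_eq_one, ← map_trans]; simp

@[simp] theorem map_cast (p : PathClass x y) {x' y' : Y} (hx : x' = x) (hy : y' = y) :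
    φ (p.cast hx hy) = φ p := by
  subst hx hy; simp

/-- Postcomposition with a group homomorphism. -/
def postcomp (f : G →* H) : PathHom Y H where
  toFun p := f (φ p)
  map_trans' p q := by rw [φ.map_trans, _root_.map_mul]

/-- Precomposition with a continuous map. -/
def precomp (f : C(X, Y)) : PathHom X G where
  toFun p := φ (p.map f)
  map_trans' p q := by rw [PathClass.map_trans, φ.map_trans]

theorem eq_of_conj {x y x' y' : Y} {p : PathClass x y} {q : PathClass x' y'}
    {a : PathClass x x'} {b : PathClass y y'} (h : p.trans b = a.trans q) :
    φ b * φ p = φ q * φ a := by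
  rw [← map_trans, ← map_trans, h]

end PathHom

/-- In a path-connected space, the fundamental groupoid retracts to the fundamental group. -/
noncomputable def PathHom.retract (Y : Type*) [TopologicalSpace Y] [PathConnectedSpace Y] (y₀ : Y) :
    PathHom Y (FundamentalGroup Y y₀) where
  toFun {x y} p := FundamentalGroup.fromPath
    (((Path.Homotopic.Quotient.mk (PathConnectedSpace.somePath y₀ x)).trans p).trans
      (Path.Homotopic.Quotient.mk (PathConnectedSpace.somePath y₀ y)).symm)
  map_trans' p q := by
    rw [FundamentalGroup.mul_def]
    simp only [Path.Homotopic.Quotient.trans_assoc, PathClass.symm_trans_trans]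

/-- The value on a loop is its conjugate by the chosen path from the base point, so one functor
detects essential loops at every point. -/
theorem PathHom.retract_eq_one_iff {Y : Type*} [TopologicalSpace Y] [PathConnectedSpace Y]
    (y₀ : Y) {x : Y} (p : PathClass x x) :
    PathHom.retract Y y₀ p = 1 ↔ p = Path.Homotopic.Quotient.refl x := by
  constructor
  · intro h
    set τ := Path.Homotopic.Quotient.mk (PathConnectedSpace.somePath y₀ x) with hτ
    have h' : (τ.trans p).trans τ.symm = Path.Homotopic.Quotient.refl y₀ := h
    calc p = τ.symm.trans (((τ.trans p).trans τ.symm).trans τ) := by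
          simp [Path.Homotopic.Quotient.trans_assoc, PathClass.symm_trans_trans]
      _ = _ := by rw [h']; simp
  · rintro rfl
    exact PathHom.map_refl _ x

/-! ### Monodromy of a locally constant cocycle. -/

section Monodromy

variable {Y ι F : Type*} [TopologicalSpace Y] (U : ι → Set Y) (hU : ∀ i, IsOpen (U i))
  (idx : Y → ι) (hidx : ∀ y, y ∈ U (idx y)) (g : ι → ι → Equiv.Perm F)
  (hg : ∀ i j k, (U i ∩ U j ∩ U k).Nonempty → g j k * g i j = g i k)

/-- The bundle of sets with locally constant transition functions `g`. -/
def cocycleBundle [TopologicalSpace F] [DiscreteTopology F] : FiberBundleCore ι Y F where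
  baseSet := U
  isOpen_baseSet := hU
  indexAt := idx
  mem_baseSet_at := hidx
  coordChange i j _ := g i j
  coordChange_self i x hx v := by
    have h := hg i i i ⟨x, ⟨hx, hx⟩, hx⟩
    have h1 : g i i = 1 := mul_eq_left.mp h
    simp [h1]
  continuousOn_coordChange i j := by
    have : Continuous fun p : Y × F => g i j p.2 :=
      (continuous_of_discreteTopology (f := g i j)).comp continuous_snd
    exact this.continuousOn
  coordChange_comp i j k x hx v := by
    have h := hg i j k ⟨x, hx⟩
    rw [← h]; rfl

include hU hidx hg in
-- The cocycle glues the sets U i × F, with F discrete, to a covering space, whose monodromy is the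
-- functor. Over a path inside U k a lift is constant in the k-th chart; the two factors translate
-- between that chart and the charts in which the end fibres are read.
theorem exists_monodromy : ∃ φ : PathHom Y (Equiv.Perm F),
    ∀ (k : ι) {x y : Y} (γ : Path x y), (∀ t, γ t ∈ U k) →
      φ (Path.Homotopic.Quotient.mk γ) = g k (idx y) * g (idx x) k := by
  classical
  let _ : TopologicalSpace F := ⊥
  have : DiscreteTopology F := ⟨rfl⟩
  let Z := cocycleBundle U hU idx hidx g hg
  have cov : IsCoveringMap Z.proj := FiberBundle.isCoveringMap (F := F) (E := Z.Fiber)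
  let e : ∀ x : Y, F ≃ Z.proj ⁻¹' {x} := fun x =>
    { toFun v := ⟨⟨x, v⟩, rfl⟩
      invFun u := u.1.2
      left_inv v := rfl
      right_inv u := by
        obtain ⟨⟨x', v⟩, hu⟩ := u
        have hu' : x' = x := hu
        subst hu'; rfl }
  let m : ∀ {x y : Y}, PathClass x y → Equiv.Perm F := fun {x y} p =>
    ((e x).trans (Equiv.ofBijective _ (cov.monodromy_bijective p))).trans (e y).symm
  refine ⟨⟨fun p => m p, fun {x y z} p q => ?_⟩, ?_⟩
  · ext v
    simp only [m, Equiv.trans_apply, Equiv.Perm.mul_apply, Equiv.ofBijective_apply,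
      Equiv.apply_symm_apply, cov.monodromy_trans_apply]
  · intro k x y γ hγ
    ext v
    show (e y).symm (cov.monodromy (Path.Homotopic.Quotient.mk γ) (e x v)) = _
    rw [Equiv.symm_apply_eq]
    -- The section that is constant in the k-th chart, starting at the point v of the fibre over x.
    let lift : C(unitInterval, Z.TotalSpace) :=
      ⟨fun t => (Z.localTriv k).invFun (γ t, g (idx x) k v), by
        refine (Z.localTriv k).continuousOn_invFun.comp_continuous (by fun_prop) fun t => ?_
        rw [(Z.localTriv k).target_eq]
        exact ⟨hγ t, trivial⟩⟩
    have hl : ∀ t, lift t = ⟨γ t, g k (idx (γ t)) (g (idx x) k v)⟩ := fun t => rfl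
    have hxx : g k (idx x) * g (idx x) k = 1 := by
      have hx : x ∈ U k := by simpa using hγ 0
      rw [hg (idx x) k (idx x) ⟨x, ⟨hidx x, hx⟩, hidx x⟩]
      have h := hg (idx x) (idx x) (idx x) ⟨x, ⟨hidx x, hidx x⟩, hidx x⟩
      exact mul_eq_left.mp h
    have h0 : lift 0 = (e x v).1 := by
      rw [hl, γ.source]
      exact congrArg (fun w => (⟨x, w⟩ : Z.TotalSpace)) (Equiv.congr_fun hxx v)
    have h1 : lift 1 = (e y ((g k (idx y) * g (idx x) k) v)).1 := by
      rw [hl, γ.target]; rfl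
    refine cov.monodromy_eq_of_map_eq (Path.Homotopic.Quotient.mk ⟨lift, h0, h1⟩) ?_
    exact congrArg Path.Homotopic.Quotient.mk (Path.ext rfl)

end Monodromy

/-! ### Restrictions of paths, and induction along the unit interval. -/

section Subpath

variable {X : Type*} [TopologicalSpace X] {x y : X}

/-- The class of the restriction of `γ` to `[s, t]`. -/
noncomputable def subClass (γ : Path x y) (s t : unitInterval) : PathClass (γ s) (γ t) :=
  Path.Homotopic.Quotient.mk (γ.subpath s t)

theorem subClass_trans (γ : Path x y) (r s t : unitInterval) :
    (subClass γ r s).trans (subClass γ s t) = subClass γ r t :=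
  Path.Homotopic.Quotient.eq.2 ⟨Path.Homotopy.subpathTransSubpath γ r s t⟩

theorem subClass_self (γ : Path x y) (t : unitInterval) :
    subClass γ t t = Path.Homotopic.Quotient.refl (γ t) := by
  simp [subClass]

theorem subClass_zero_one (γ : Path x y) :
    subClass γ 0 1 = (Path.Homotopic.Quotient.mk γ).cast γ.source γ.target := by
  simp [subClass]

/-- At s = t the subpath is constant, and compactness of the interval makes the estimate uniform in
r. -/
theorem eventually_subpath_mem (γ : Path x y) (t : unitInterval) {O : Set X} (hO : O ∈ 𝓝 (γ t)) :
    ∀ᶠ s in 𝓝 t, ∀ r, γ.subpath t s r ∈ O := by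
  have hc : Continuous fun p : unitInterval × unitInterval => γ.subpath t p.1 p.2 :=
    γ.subpath_continuous_family.comp (by fun_prop : Continuous fun p : unitInterval × unitInterval =>
      (t, p.1, p.2))
  have := isCompact_univ.eventually_forall_of_forall_eventually (x₀ := t)
    (P := fun s r => γ.subpath t s r ∈ O) (K := (Set.univ : Set unitInterval)) fun r _ => by
      refine hc.continuousAt.preimage_mem_nhds ?_
      simpa using hO
  simpa using this

/-- Connectedness of the interval. The local hypothesis is an equivalence, so no subdivision of the
interval has to be chosen. -/
theorem unitInterval_induction {P : unitInterval → Prop} (h0 : P 0)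
    (h : ∀ t, ∀ᶠ s in 𝓝 t, (P s ↔ P t)) : P 1 := by
  have hc : IsLocallyConstant P := by
    rw [IsLocallyConstant.iff_eventually_eq]
    exact fun t => (h t).mono fun s hs => propext hs
  have := hc.apply_eq_of_isPreconnected isPreconnected_univ (Set.mem_univ 0) (Set.mem_univ 1)
  rwa [← this]

end Subpath

/-! ### Straight paths in a geometric realization. -/

namespace GeomRealization

variable {V : Type*} {K : AbstractSimplicialComplex V}

theorem continuous_simplexMap (σ : K.faces) : Continuous (simplexMap K σ) :=
  continuous_iSup_rng (i := σ) continuous_coinduced_rng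

theorem simplexMap_coord (σ : K.faces) (a : stdSimplex ℝ σ.1) (v : σ.1) :
    (simplexMap K σ a).coord v = a.1 v :=
  Finsupp.embDomain_apply_self (Function.Embedding.subtype (· ∈ σ.1)) _ v

theorem simplexMap_coord_of_notMem (σ : K.faces) (a : stdSimplex ℝ σ.1) {v : V} (hv : v ∉ σ.1) :
    (simplexMap K σ a).coord v = 0 := by
  refine Finsupp.embDomain_of_notMem_range _ _ _ ?_
  rintro ⟨w, rfl⟩
  exact hv w.2

/-- Barycentric coordinates, in the simplex `σ`, of a point of `σ`. -/
noncomputable def toSimplex (σ : K.faces) (p : GeomRealization K) (hp : p.coord.support ⊆ σ.1) :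
    stdSimplex ℝ σ.1 :=
  ⟨fun v => p.coord v, fun v => p.nonneg v, by
    rw [Finset.sum_coe_sort σ.1 (fun v => p.coord v), ← p.sum_eq_one]
    exact (Finset.sum_subset hp fun v _ hv => Finsupp.notMem_support_iff.1 hv).symm⟩

@[simp] theorem simplexMap_toSimplex (σ : K.faces) (p : GeomRealization K)
    (hp : p.coord.support ⊆ σ.1) : simplexMap K σ (toSimplex σ p hp) = p := by
  ext v
  by_cases hv : v ∈ σ.1
  · exact simplexMap_coord σ _ ⟨v, hv⟩
  · rw [simplexMap_coord_of_notMem σ _ hv]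
    exact (Finsupp.notMem_support_iff.1 fun h => hv (hp h)).symm

/-- The affine combination `(1 - t) a + t b` in a simplex. -/
noncomputable def combo {σ : Finset V} (a b : stdSimplex ℝ σ) (t : unitInterval) : stdSimplex ℝ σ :=
  ⟨(1 - t : ℝ) • a.1 + (t : ℝ) • b.1,
    convex_stdSimplex ℝ σ a.2 b.2 (by linarith [t.2.2]) t.2.1 (by ring)⟩

theorem continuous_combo {σ : Finset V} :
    Continuous fun q : stdSimplex ℝ σ × stdSimplex ℝ σ × unitInterval => combo q.1 q.2.1 q.2.2 := by
  refine Continuous.subtype_mk ?_ _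
  fun_prop

theorem simplexMap_combo_coord (σ : K.faces) (a b : stdSimplex ℝ σ.1) (t : unitInterval) (v : V) :
    (simplexMap K σ (combo a b t)).coord v =
      (1 - t) * (simplexMap K σ a).coord v + t * (simplexMap K σ b).coord v := by
  by_cases hv : v ∈ σ.1
  · simp only [simplexMap_coord σ _ ⟨v, hv⟩]
    simp [combo]
  · simp [simplexMap_coord_of_notMem σ _ hv]

/-- The straight path from `p` to `q` in a common simplex `σ`. -/
noncomputable def segment (σ : K.faces) {p q : GeomRealization K} (hp : p.coord.support ⊆ σ.1)
    (hq : q.coord.support ⊆ σ.1) : Path p q where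
  toFun t := simplexMap K σ (combo (toSimplex σ p hp) (toSimplex σ q hq) t)
  continuous_toFun := (continuous_simplexMap σ).comp
    (continuous_combo.comp (by fun_prop : Continuous fun t : unitInterval =>
      (toSimplex σ p hp, toSimplex σ q hq, t)))
  source' := by
    ext v
    simp [simplexMap_combo_coord]
  target' := by
    ext v
    simp [simplexMap_combo_coord]

theorem segment_coord (σ : K.faces) {p q : GeomRealization K} (hp : p.coord.support ⊆ σ.1)
    (hq : q.coord.support ⊆ σ.1) (t : unitInterval) (v : V) :
    (segment σ hp hq t).coord v = (1 - t) * p.coord v + t * q.coord v := by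
  have := simplexMap_combo_coord σ (toSimplex σ p hp) (toSimplex σ q hq) t v
  rwa [simplexMap_toSimplex, simplexMap_toSimplex] at this

theorem segment_eq (σ τ : K.faces) {p q : GeomRealization K} (hp : p.coord.support ⊆ σ.1)
    (hq : q.coord.support ⊆ σ.1) (hp' : p.coord.support ⊆ τ.1) (hq' : q.coord.support ⊆ τ.1) :
    segment σ hp hq = segment τ hp' hq' := by
  ext t v
  rw [segment_coord, segment_coord]

theorem simplyConnectedSpace_stdSimplex (σ : K.faces) : SimplyConnectedSpace (stdSimplex ℝ σ.1) := by
  have hne : (stdSimplex ℝ σ.1).Nonempty := by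
    obtain ⟨v, hv⟩ := (K.isRelLowerSet_faces σ.2).1
    classical
    exact ⟨_, single_mem_stdSimplex ℝ (⟨v, hv⟩ : σ.1)⟩
  have := (convex_stdSimplex ℝ σ.1).contractibleSpace hne
  infer_instance

/-- Both sides are images of paths in one simplex, which is convex and hence simply connected. -/
theorem segment_trans (σ : K.faces) {p q r : GeomRealization K} (hp : p.coord.support ⊆ σ.1)
    (hq : q.coord.support ⊆ σ.1) (hr : r.coord.support ⊆ σ.1) :
    (Path.Homotopic.Quotient.mk (segment σ hp hq)).trans
      (Path.Homotopic.Quotient.mk (segment σ hq hr)) =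
      Path.Homotopic.Quotient.mk (segment σ hp hr) := by
  have := simplyConnectedSpace_stdSimplex σ
  let line : ∀ a b : stdSimplex ℝ σ.1, Path a b := fun a b =>
    { toFun t := combo a b t
      continuous_toFun := continuous_combo.comp (by fun_prop : Continuous fun t : unitInterval =>
        (a, b, t))
      source' := by ext v; simp [combo]
      target' := by ext v; simp [combo] }
  let f : C(stdSimplex ℝ σ.1, GeomRealization K) := ⟨simplexMap K σ, continuous_simplexMap σ⟩
  have key : ∀ {p q : GeomRealization K} (hp : p.coord.support ⊆ σ.1)
      (hq : q.coord.support ⊆ σ.1), segment σ hp hq =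
      ((line (toSimplex σ p hp) (toSimplex σ q hq)).map f.continuous).cast
        (simplexMap_toSimplex σ p hp).symm (simplexMap_toSimplex σ q hq).symm :=
    fun hp hq => Path.ext rfl
  rw [key hp hq, key hq hr, key hp hr, ← Path.Homotopic.Quotient.mk_trans]
  refine Path.Homotopic.Quotient.eq.2 ?_
  have h := (SimplyConnectedSpace.paths_homotopic ((line (toSimplex σ p hp) (toSimplex σ q hq)).trans
    (line (toSimplex σ q hq) (toSimplex σ r hr))) (line (toSimplex σ p hp) (toSimplex σ r hr))).map f
  have h' := h.pathCast (simplexMap_toSimplex σ p hp).symm (simplexMap_toSimplex σ r hr).symm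
  convert h' using 1
  rw [Path.map_trans]
  rfl

theorem segment_self (σ : K.faces) {p : GeomRealization K} (hp : p.coord.support ⊆ σ.1) :
    segment σ hp hp = Path.refl p := by
  ext t v
  rw [segment_coord]; simp; ring

theorem vertex_coord_self (v : V) : (vertex K v).coord v = 1 := by simp [vertex]

theorem support_vertex (v : V) : (vertex K v).coord.support = {v} :=
  Finsupp.support_single v one_ne_zero

theorem support_vertex_subset {v : V} {σ : Finset V} (h : v ∈ σ) :
    (vertex K v).coord.support ⊆ σ := by
  rw [support_vertex]; simpa using h

/-! ### Open stars -/

/-- The open star of the vertex `v`. -/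
def openStar (K : AbstractSimplicialComplex V) (v : V) : Set (GeomRealization K) :=
  {p | p.coord v ≠ 0}

theorem isOpen_iff {s : Set (GeomRealization K)} :
    IsOpen s ↔ ∀ σ : K.faces, IsOpen (simplexMap K σ ⁻¹' s) := by
  rw [isOpen_iSup_iff]; rfl

theorem isOpen_openStar (v : V) : IsOpen (openStar K v) := by
  rw [isOpen_iff]
  intro σ
  by_cases hv : v ∈ σ.1
  · have : simplexMap K σ ⁻¹' openStar K v = {a | a.1 ⟨v, hv⟩ ≠ 0} := by
      ext a
      show (simplexMap K σ a).coord v ≠ 0 ↔ _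
      rw [simplexMap_coord σ a ⟨v, hv⟩]; rfl
    rw [this]
    exact isOpen_ne_fun ((continuous_apply (⟨v, hv⟩ : σ.1)).comp continuous_subtype_val)
      continuous_const
  · have : simplexMap K σ ⁻¹' openStar K v = ∅ := by
      ext a
      simp [openStar, simplexMap_coord_of_notMem σ a hv]
    rw [this]
    exact isOpen_empty

/-- The simplex carrying a point. -/
def carrier (p : GeomRealization K) : K.faces := ⟨p.coord.support, p.support_mem⟩

theorem support_subset_carrier (p : GeomRealization K) : p.coord.support ⊆ (carrier p).1 :=
  Finset.Subset.refl _

theorem mem_carrier {p : GeomRealization K} {v : V} (hp : p ∈ openStar K v) : v ∈ (carrier p).1 :=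
  Finsupp.mem_support_iff.2 hp

theorem vertex_support_subset_carrier {p : GeomRealization K} {v : V} (hp : p ∈ openStar K v) :
    (vertex K v).coord.support ⊆ (carrier p).1 :=
  support_vertex_subset (mem_carrier hp)

/-- The straight path from a point of the open star of `v` to `v`. -/
noncomputable def starPath (v : V) (p : openStar K v) : Path p.1 (vertex K v) :=
  segment (carrier p.1) (support_subset_carrier p.1) (vertex_support_subset_carrier p.2)

/-- By the weak topology, openness can be tested on each simplex. There the family is a curried
continuous map, because the straight path does not depend on the simplex used to write it. -/
theorem continuous_starPath (v : V) :
    Continuous fun p : openStar K v => (starPath v p : C(unitInterval, GeomRealization K)) := by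
  rw [continuous_def]
  intro O hO
  rw [(isOpen_openStar v).isOpenEmbedding_subtypeVal.isOpen_iff_image_isOpen, isOpen_iff]
  intro σ
  by_cases hv : v ∈ σ.1
  · let F : C(stdSimplex ℝ σ.1, C(unitInterval, GeomRealization K)) :=
      ContinuousMap.curry ⟨fun q => simplexMap K σ
        (combo q.1 (toSimplex σ (vertex K v) (support_vertex_subset hv)) q.2),
        (continuous_simplexMap σ).comp (continuous_combo.comp
          (continuous_fst.prodMk (continuous_const.prodMk continuous_snd)))⟩
    have hF : ∀ (a : stdSimplex ℝ σ.1) (ha : simplexMap K σ a ∈ openStar K v),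
        (starPath v ⟨_, ha⟩ : C(unitInterval, GeomRealization K)) = F a := by
      intro a ha
      ext t w
      refine (segment_coord _ _ _ t w).trans ?_
      refine ((simplexMap_combo_coord σ _ _ t w).trans ?_).symm
      rw [simplexMap_toSimplex]
    have : simplexMap K σ ⁻¹' (Subtype.val '' ((fun p : openStar K v =>
        (starPath v p : C(unitInterval, GeomRealization K))) ⁻¹' O)) =
        simplexMap K σ ⁻¹' openStar K v ∩ F ⁻¹' O := by
      ext a
      constructor
      · rintro ⟨p, hp, hpa⟩
        have ha : simplexMap K σ a ∈ openStar K v := hpa ▸ p.2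
        have hpe : p = ⟨_, ha⟩ := Subtype.ext hpa
        subst hpe
        refine ⟨ha, ?_⟩
        rw [Set.mem_preimage, ← hF a ha]
        exact hp
      · rintro ⟨ha, hO⟩
        refine ⟨⟨_, ha⟩, ?_, rfl⟩
        rw [Set.mem_preimage, ← hF a ha] at hO
        exact hO
    rw [this]
    exact (isOpen_iff.1 (isOpen_openStar v) σ).inter (hO.preimage F.continuous)
  · convert isOpen_empty
    ext a
    simp [openStar, simplexMap_coord_of_notMem σ a hv]

/-- The class of the straight path from a point of the open star of `v` to `v`. -/
noncomputable def starClass {v : V} {p : GeomRealization K} (hp : p ∈ openStar K v) :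
    PathClass p (vertex K v) :=
  Path.Homotopic.Quotient.mk (starPath v ⟨p, hp⟩)

/-- Straight lines contract the open star to v, and the square traced by γ under this contraction
has a constant side. -/
theorem trans_starClass {v : V} {p q : GeomRealization K} (γ : Path p q)
    (h : ∀ t, γ t ∈ openStar K v) (hp : p ∈ openStar K v) (hq : q ∈ openStar K v) :
    (Path.Homotopic.Quotient.mk γ).trans (starClass hq) = starClass hp := by
  let H : ContinuousMap.Homotopy (⟨Subtype.val, continuous_subtype_val⟩ :
      C(openStar K v, GeomRealization K)) (ContinuousMap.const _ (vertex K v)) :=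
    { toFun x := starPath v x.2 x.1
      continuous_toFun := by
        have h1 : Continuous fun x : unitInterval × openStar K v =>
            ((starPath v x.2 : C(unitInterval, GeomRealization K)), x.1) :=
          ((continuous_starPath v).comp continuous_snd).prodMk continuous_fst
        exact continuous_eval.comp h1
      map_zero_left x := (starPath v x).source
      map_one_left x := (starPath v x).target }
  let γ' : Path (⟨p, hp⟩ : openStar K v) ⟨q, hq⟩ :=
    { toFun t := ⟨γ t, h t⟩
      continuous_toFun := by fun_prop
      source' := Subtype.ext γ.source
      target' := Subtype.ext γ.target }
  have e := Path.Homotopic.Quotient.eq.2 (Path.Homotopic.map_trans_evalAt H γ')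
  have e' : (Path.Homotopic.Quotient.mk γ).trans (starClass hq) =
      (starClass hp).trans (Path.Homotopic.Quotient.refl _) := e
  rw [e', Path.Homotopic.Quotient.trans_refl]

/-! ### Edge paths -/

/-- The vertices `v` and `w` lie in a common simplex. -/
def Adjacent (K : AbstractSimplicialComplex V) (v w : V) : Prop := ∃ σ : K.faces, v ∈ σ.1 ∧ w ∈ σ.1

theorem Adjacent.intro {v w : V} (σ : K.faces) (hv : v ∈ σ.1) (hw : w ∈ σ.1) : Adjacent K v w :=
  ⟨σ, hv, hw⟩

/-- The class of the straight path between two vertices of a simplex. -/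
noncomputable def edge {v w : V} (h : Adjacent K v w) : PathClass (vertex K v) (vertex K w) :=
  Path.Homotopic.Quotient.mk (segment h.choose (support_vertex_subset h.choose_spec.1)
    (support_vertex_subset h.choose_spec.2))

theorem edge_eq {v w : V} (h : Adjacent K v w) (σ : K.faces) (hv : v ∈ σ.1) (hw : w ∈ σ.1) :
    edge h = Path.Homotopic.Quotient.mk
      (segment σ (support_vertex_subset hv) (support_vertex_subset hw)) := by
  rw [edge, segment_eq]

theorem edge_trans {u v w : V} (σ : K.faces) (hu : u ∈ σ.1) (hv : v ∈ σ.1) (hw : w ∈ σ.1) :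
    (edge (.intro σ hu hv)).trans (edge (.intro σ hv hw)) = edge (.intro σ hu hw) := by
  rw [edge_eq _ σ hu hv, edge_eq _ σ hv hw, edge_eq _ σ hu hw, segment_trans]

theorem edge_self {v : V} (h : Adjacent K v v) :
    edge h = Path.Homotopic.Quotient.refl (vertex K v) := by
  rw [edge, segment_self]; rfl

theorem starClass_eq {v : V} {p : GeomRealization K} (hp : p ∈ openStar K v) (σ : K.faces)
    (hσ : p.coord.support ⊆ σ.1) (hv : v ∈ σ.1) :
    starClass hp = Path.Homotopic.Quotient.mk (segment σ hσ (support_vertex_subset hv)) := by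
  rw [starClass, starPath, segment_eq _ σ _ _ hσ (support_vertex_subset hv)]

theorem adjacent_of_mem_openStar {v w : V} {p : GeomRealization K} (hv : p ∈ openStar K v)
    (hw : p ∈ openStar K w) : Adjacent K v w :=
  ⟨carrier p, mem_carrier hv, mem_carrier hw⟩

theorem starClass_trans_edge {v w : V} {p : GeomRealization K} (hv : p ∈ openStar K v)
    (hw : p ∈ openStar K w) (h : Adjacent K v w) :
    (starClass hv).trans (edge h) = starClass hw := by
  rw [starClass_eq hv (carrier p) (support_subset_carrier p) (mem_carrier hv),
    edge_eq h (carrier p) (mem_carrier hv) (mem_carrier hw), segment_trans,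
    starClass_eq hw (carrier p) (support_subset_carrier p) (mem_carrier hw)]

theorem vertex_mem_openStar (v : V) : vertex K v ∈ openStar K v := by
  show (vertex K v).coord v ≠ 0
  rw [vertex_coord_self]; exact one_ne_zero

theorem starClass_vertex (v : V) (h : vertex K v ∈ openStar K v) :
    starClass h = Path.Homotopic.Quotient.refl (vertex K v) := by
  rw [starClass_eq h (carrier _) (support_subset_carrier _) (mem_carrier h), segment_self]; rfl

/-- Products of edges. -/
inductive IsEdgeChain (K : AbstractSimplicialComplex V) :
    ∀ {v w : V}, PathClass (vertex K v) (vertex K w) → Prop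
  | refl (v : V) : IsEdgeChain K (Path.Homotopic.Quotient.refl (vertex K v))
  | trans_edge {u v w : V} (q : PathClass (vertex K u) (vertex K v)) (hq : IsEdgeChain K q)
      (h : Adjacent K v w) : IsEdgeChain K (q.trans (edge h))

/-- `q` becomes an edge path when its endpoints are pushed to the vertices `v` and `w`. -/
def PushesToEdgeChain {p p' : GeomRealization K} (q : PathClass p p') (v w : V) : Prop :=
  ∃ (hv : p ∈ openStar K v) (hw : p' ∈ openStar K w),
    IsEdgeChain K ((starClass hv).symm.trans (q.trans (starClass hw)))

theorem PushesToEdgeChain.right {p p' : GeomRealization K} {q : PathClass p p'} {v w u : V}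
    (h : PushesToEdgeChain q v w) (hu : p' ∈ openStar K u) : PushesToEdgeChain q v u := by
  obtain ⟨hv, hw, hc⟩ := h
  refine ⟨hv, hu, ?_⟩
  have := hc.trans_edge _ (adjacent_of_mem_openStar hw hu)
  rwa [Path.Homotopic.Quotient.trans_assoc, Path.Homotopic.Quotient.trans_assoc,
    starClass_trans_edge hw hu] at this

theorem pushesToEdgeChain_cast {p p' r r' : GeomRealization K} {q : PathClass p p'} {v w : V}
    (hr : r = p) (hr' : r' = p') (h : PushesToEdgeChain (q.cast hr hr') v w) :
    PushesToEdgeChain q v w := by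
  subst hr hr'
  rwa [Path.Homotopic.Quotient.cast_rfl_rfl] at h

theorem exists_mem_openStar (p : GeomRealization K) : ∃ v, p ∈ openStar K v := by
  obtain ⟨v, hv⟩ := (K.isRelLowerSet_faces p.support_mem).1
  exact ⟨v, Finsupp.mem_support_iff.1 hv⟩

/-- Induction along γ. While γ stays in one open star, pushing its endpoint to the centre of the
star gives the same class; passing to another star that contains the endpoint appends an edge. -/
theorem pushesToEdgeChain {p p' : GeomRealization K} (q : PathClass p p') {v w : V}
    (hv : p ∈ openStar K v) (hw : p' ∈ openStar K w) : PushesToEdgeChain q v w := by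
  obtain ⟨γ, rfl⟩ := Path.Homotopic.Quotient.mk_surjective q
  have hv' : γ 0 ∈ openStar K v := by rwa [γ.source]
  have main : ∃ u, PushesToEdgeChain (subClass γ 0 1) v u := by
    refine unitInterval_induction (P := fun t => ∃ u, PushesToEdgeChain (subClass γ 0 t) v u)
      ⟨v, hv', hv', ?_⟩ fun t => ?_
    · rw [subClass_self, Path.Homotopic.Quotient.refl_trans, Path.Homotopic.Quotient.symm_trans]
      exact .refl v
    · obtain ⟨u, hu⟩ := exists_mem_openStar (γ t)
      filter_upwards [eventually_subpath_mem γ t ((isOpen_openStar u).mem_nhds hu)] with s hs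
      have hsu : γ s ∈ openStar K u := by simpa using hs 1
      have e : (subClass γ 0 s).trans (starClass hsu) = (subClass γ 0 t).trans (starClass hu) := by
        rw [← trans_starClass (γ.subpath t s) hs hu hsu, ← Path.Homotopic.Quotient.trans_assoc,
          ← subClass, subClass_trans]
      constructor
      · rintro ⟨u', h⟩
        obtain ⟨h1, h2, h3⟩ := h.right hsu
        exact ⟨u, h1, hu, by rwa [← e]⟩
      · rintro ⟨u', h⟩
        obtain ⟨h1, h2, h3⟩ := h.right hu
        exact ⟨u, h1, hsu, by rwa [e]⟩
  obtain ⟨u, hu⟩ := main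
  rw [subClass_zero_one] at hu
  exact (pushesToEdgeChain_cast _ _ hu).right hw

/-- Every path between vertices is homotopic to an edge path. -/
theorem isEdgeChain {v w : V} (q : PathClass (vertex K v) (vertex K w)) : IsEdgeChain K q := by
  obtain ⟨h1, h2, h3⟩ := pushesToEdgeChain q (vertex_mem_openStar v) (vertex_mem_openStar w)
  rw [starClass_vertex, starClass_vertex, Path.Homotopic.Quotient.trans_refl] at h3
  have : (Path.Homotopic.Quotient.refl (vertex K v)).symm =
      Path.Homotopic.Quotient.refl (vertex K v) := by
    rw [← Path.Homotopic.Quotient.mk_refl, ← Path.Homotopic.Quotient.mk_symm, Path.refl_symm]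
  rwa [this, Path.Homotopic.Quotient.refl_trans] at h3

/-- Two functors on the fundamental groupoid that agree on edges agree on paths between vertices. -/
theorem eq_of_eq_on_edges {G : Type*} [Group G] {φ ψ : PathHom (GeomRealization K) G}
    (h : ∀ {v w : V} (e : Adjacent K v w), φ (edge e) = ψ (edge e)) {v w : V}
    (q : PathClass (vertex K v) (vertex K w)) : φ q = ψ q := by
  have hq := isEdgeChain q
  induction hq with
  | refl => simp
  | trans_edge q _ e ih => rw [φ.map_trans, ψ.map_trans, ih, h]

/-- A cocycle on the edges of `K` extends to the fundamental groupoid. -/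
theorem exists_pathHom_of_cocycle {F : Type*} (g : V → V → Equiv.Perm F)
    (hg : ∀ (σ : K.faces) (u v w : V), u ∈ σ.1 → v ∈ σ.1 → w ∈ σ.1 → g v w * g u v = g u w) :
    ∃ φ : PathHom (GeomRealization K) (Equiv.Perm F),
      ∀ {v w : V} (h : Adjacent K v w), φ (edge h) = g v w := by
  -- Open stars cover the realization, and stars with a common point have centres in a common
  -- simplex, so g is a cocycle for this cover.
  choose idx hidx using exists_mem_openStar (K := K)
  obtain ⟨φ, hφ⟩ := exists_monodromy (openStar K) isOpen_openStar idx hidx g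
    fun i j k ⟨p, ⟨hi, hj⟩, hk⟩ => hg (carrier p) i j k (mem_carrier hi) (mem_carrier hj) (mem_carrier hk)
  have hidxv : ∀ v, idx (vertex K v) = v := fun v => by
    have := mem_carrier (hidx (vertex K v))
    have h2 : idx (vertex K v) ∈ ({v} : Finset V) := support_vertex (K := K) v ▸ this
    simpa using h2
  have h1 : ∀ v, g v v = 1 := fun v => by
    have := hg (carrier (vertex K v)) v v v (mem_carrier (vertex_mem_openStar v))
      (mem_carrier (vertex_mem_openStar v)) (mem_carrier (vertex_mem_openStar v))
    exact mul_eq_left.mp this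
  have hstar : ∀ {p : GeomRealization K} {v : V} (hp : p ∈ openStar K v),
      φ (starClass hp) = g (idx p) v := fun {p v} hp => by
    rw [starClass, hφ v, hidxv, h1, one_mul]
    intro t
    show (starPath v ⟨p, hp⟩ t).coord v ≠ 0
    have e : (starPath v ⟨p, hp⟩ t).coord v = (1 - t) * p.coord v + t * (vertex K v).coord v :=
      segment_coord (carrier p) (support_subset_carrier p)
        (support_vertex_subset (mem_carrier hp)) t v
    rw [e, vertex_coord_self]
    have hp0 : 0 < p.coord v := lt_of_le_of_ne (p.nonneg v) (Ne.symm hp)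
    rcases eq_or_lt_of_le t.2.2 with ht | ht
    · simp [ht]
    · have : 0 < (1 - (t : ℝ)) * p.coord v := mul_pos (by linarith) hp0
      have := t.2.1
      intro h
      linarith
  refine ⟨φ, fun {v w} h => ?_⟩
  obtain ⟨σ, hv, hw⟩ := h
  -- The midpoint lies in both open stars. The edge is compared with the two star paths issuing from
  -- m, whose values under φ are known.
  let m : GeomRealization K := segment σ (support_vertex_subset hv) (support_vertex_subset hw)
    ⟨1 / 2, by norm_num, by norm_num⟩
  have hm : ∀ u, m.coord u = 1 / 2 * (vertex K v).coord u + 1 / 2 * (vertex K w).coord u :=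
    fun u => (segment_coord _ _ _ _ u).trans (by norm_num)
  have hmv : m ∈ openStar K v := by
    show m.coord v ≠ 0
    rw [hm, vertex_coord_self]
    have := (vertex K w).nonneg v
    positivity
  have hmw : m ∈ openStar K w := by
    show m.coord w ≠ 0
    rw [hm, vertex_coord_self]
    have := (vertex K v).nonneg w
    positivity
  have e := congrArg φ.toFun (starClass_trans_edge hmv hmw ⟨σ, hv, hw⟩)
  rw [φ.map_trans, hstar, hstar, ← hg (carrier m) (idx m) v w (mem_carrier (hidx m)) (mem_carrier hmv)
    (mem_carrier hmw)] at e
  exact mul_right_cancel e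

theorem edge_map_inclusion {L : AbstractSimplicialComplex V} (hKL : K.faces ⊆ L.faces) {v w : V}
    (h : Adjacent K v w) (h' : Adjacent L v w) :
    Path.Homotopic.Quotient.map (edge h) (inclusion hKL) = edge h' := by
  obtain ⟨σ, hv, hw⟩ := h
  rw [edge_eq (.intro σ hv hw) σ hv hw, edge_eq h' ⟨σ.1, hKL σ.2⟩ hv hw, ← Path.Homotopic.Quotient.mk_map]
  refine congrArg Path.Homotopic.Quotient.mk ?_
  ext t u
  exact (segment_coord σ (support_vertex_subset hv) (support_vertex_subset hw) t u).trans
    (segment_coord (K := L) ⟨σ.1, hKL σ.2⟩ (support_vertex_subset hv)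
      (support_vertex_subset hw) t u).symm

theorem joined_vertex {p : GeomRealization K} {v : V} (hp : p ∈ openStar K v) :
    Joined p (vertex K v) := ⟨starPath v ⟨p, hp⟩⟩

theorem Adjacent.joined {v w : V} (h : Adjacent K v w) : Joined (vertex K v) (vertex K w) :=
  ⟨segment h.choose (support_vertex_subset h.choose_spec.1)
    (support_vertex_subset h.choose_spec.2)⟩

end GeomRealization

namespace PathClass

variable {X : Type*} [TopologicalSpace X] {x y z : X}

theorem trans_right_cancel {p q : PathClass x y} {r : PathClass y z} (h : p.trans r = q.trans r) :
    p = q := by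
  have := congrArg (fun u => Path.Homotopic.Quotient.trans u r.symm) h
  simpa [Path.Homotopic.Quotient.trans_assoc] using this

end PathClass

/-! ### Lengths of path classes, geodesics, and homotopy of nearby paths. -/

section Length

variable {X : Type*} [MetricSpace X]

/-- `f` is Lipschitz with constant `L`. -/
def HasLipschitzConst {α : Type*} [MetricSpace α] (L : ℝ) (f : α → X) : Prop :=
  ∀ s t, dist (f s) (f t) ≤ L * dist s t

/-- The path class `q` is represented by a path of length at most `L`,
parametrized with speed at most `L`. -/
def HasLength {x y : X} (q : PathClass x y) (L : ℝ) : Prop :=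
  ∃ γ : Path x y, HasLipschitzConst L γ ∧ Path.Homotopic.Quotient.mk γ = q

theorem unitInterval_dist_zero_one : dist (0 : unitInterval) 1 = 1 := by
  rw [Subtype.dist_eq]; norm_num

namespace HasLength

variable {x y z : X}

theorem dist_le {q : PathClass x y} {L : ℝ} (h : HasLength q L) : dist x y ≤ L := by
  obtain ⟨γ, h, -⟩ := h
  have := h 0 1
  rwa [unitInterval_dist_zero_one, γ.source, γ.target, mul_one] at this

theorem nonneg {q : PathClass x y} {L : ℝ} (h : HasLength q L) : 0 ≤ L :=
  dist_nonneg.trans h.dist_le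

theorem mono {q : PathClass x y} {L L' : ℝ} (h : HasLength q L) (hL : L ≤ L') :
    HasLength q L' := by
  obtain ⟨γ, h, e⟩ := h
  exact ⟨γ, fun s t => (h s t).trans (mul_le_mul_of_nonneg_right hL dist_nonneg), e⟩

theorem symm {q : PathClass x y} {L : ℝ} (h : HasLength q L) : HasLength q.symm L := by
  obtain ⟨γ, h, rfl⟩ := h
  refine ⟨γ.symm, fun s t => ?_, rfl⟩
  refine (h _ _).trans_eq ?_
  congr 1
  simp only [Subtype.dist_eq, Real.dist_eq, unitInterval.coe_symm_eq]
  rw [abs_sub_comm]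
  congr 1; ring

theorem cast {q : PathClass x y} {L : ℝ} (h : HasLength q L) {x' y' : X} (hx : x' = x)
    (hy : y' = y) : HasLength (q.cast hx hy) L := by
  subst hx hy
  rwa [Path.Homotopic.Quotient.cast_rfl_rfl]

theorem of_cast {q : PathClass x y} {L : ℝ} {x' y' : X} {hx : x' = x}
    {hy : y' = y} (h : HasLength (q.cast hx hy) L) : HasLength q L := by
  subst hx hy
  rwa [Path.Homotopic.Quotient.cast_rfl_rfl] at h

theorem refl (x : X) : HasLength (Path.Homotopic.Quotient.refl x) 0 :=
  ⟨Path.refl x, fun s t => by simp, rfl⟩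

theorem eq_refl {q : PathClass x y} (h : HasLength q 0) :
    ∃ e : x = y, q = (Path.Homotopic.Quotient.refl y).cast e rfl := by
  have e : x = y := dist_le_zero.1 h.dist_le
  subst e
  refine ⟨rfl, ?_⟩
  obtain ⟨γ, h, rfl⟩ := h
  have : γ = Path.refl x := by
    ext t
    have := h t 0
    rw [zero_mul, γ.source] at this
    exact dist_le_zero.1 this
  rw [this]; simp

theorem extend_lipschitz {γ : Path x y} {L : ℝ} (hL : 0 ≤ L) (h : HasLipschitzConst L γ) (s t : ℝ) :
    dist (γ.extend s) (γ.extend t) ≤ L * |s - t| := by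
  refine (h _ _).trans (mul_le_mul_of_nonneg_left ?_ hL)
  have := (LipschitzWith.projIcc (zero_le_one (α := ℝ))).dist_le_mul s t
  simpa [Real.dist_eq] using this

theorem trans {p : PathClass x y} {q : PathClass y z} {L M : ℝ} (hp : HasLength p L)
    (hq : HasLength q M) : HasLength (p.trans q) (L + M) := by
  rcases hp.nonneg.eq_or_lt with rfl | hL
  · obtain ⟨rfl, rfl⟩ := hp.eq_refl
    simpa using hq
  rcases hq.nonneg.eq_or_lt with rfl | hM
  · obtain ⟨rfl, rfl⟩ := hq.eq_refl
    simpa using hp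
  obtain ⟨γ, hγ, rfl⟩ := hp
  obtain ⟨δ, hδ, rfl⟩ := hq
  -- Each path gets a share of the parameter interval proportional to its length, so that both are
  -- run through at speed at most L + M.
  set a : ℝ := L / (L + M) with ha
  have hLM : 0 < L + M := by linarith
  have ha0 : 0 < a := div_pos hL hLM
  have ha1 : 0 < 1 - a := by
    have : 1 - a = M / (L + M) := by rw [ha]; field_simp; ring
    rw [this]; exact div_pos hM hLM
  have hLa : L / a = L + M := by rw [ha]; field_simp
  have hMa : M / (1 - a) = L + M := by
    have : 1 - a = M / (L + M) := by rw [ha]; field_simp; ring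
    rw [this]; field_simp
  let F : ℝ → ℝ := fun t => if t ≤ a then t / (2 * a) else 1 / 2 + (t - a) / (2 * (1 - a))
  have hF : Continuous F := by
    refine continuous_if_le (by fun_prop) (by fun_prop) (by fun_prop) (by fun_prop) ?_
    intro t ht
    rw [ht]; field_simp; ring
  have hFI : ∀ t : unitInterval, F t ∈ unitInterval := by
    intro t
    have h0 := t.2.1
    have h1 := t.2.2
    by_cases h : (t : ℝ) ≤ a
    · simp only [F, if_pos h]
      exact ⟨by positivity, by rw [div_le_one (by linarith)]; linarith⟩
    · simp only [F, if_neg h]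
      push Not at h
      have : (t - a) / (2 * (1 - a)) ≤ 1 / 2 := by
        rw [div_le_div_iff₀ (by linarith) (by norm_num)]; linarith
      have h2 : 0 ≤ (t - a) / (2 * (1 - a)) := div_nonneg (by linarith) (by linarith)
      exact ⟨by linarith, by linarith⟩
  let f : unitInterval → unitInterval := fun t => ⟨F t, hFI t⟩
  have hf : Continuous f := by fun_prop
  have hf0 : f 0 = 0 := by
    apply Subtype.ext
    show F 0 = 0
    simp [F, ha0.le]
  have hf1 : f 1 = 1 := by
    apply Subtype.ext
    show F 1 = 1
    have : ¬ (1 : ℝ) ≤ a := by linarith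
    simp only [F, if_neg this]; field_simp; ring
  refine ⟨(γ.trans δ).reparam f hf hf0 hf1, ?_, ?_⟩
  · have val : ∀ t : unitInterval, (γ.trans δ).reparam f hf hf0 hf1 t =
        if (t : ℝ) ≤ a then γ.extend (t / a) else δ.extend ((t - a) / (1 - a)) := by
      intro t
      show (if F t ≤ 1 / 2 then γ.extend (2 * F t) else δ.extend (2 * F t - 1)) = _
      by_cases h : (t : ℝ) ≤ a
      · have h2 : F t = t / (2 * a) := if_pos h
        have h3 : F t ≤ 1 / 2 := by
          rw [h2, div_le_div_iff₀ (by linarith) (by norm_num)]; linarith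
        rw [if_pos h, if_pos h3, h2]
        congr 1; field_simp
      · have h2 : F t = 1 / 2 + (t - a) / (2 * (1 - a)) := if_neg h
        push Not at h
        have h3 : ¬ F t ≤ 1 / 2 := by
          rw [h2]
          have : 0 < (t - a) / (2 * (1 - a)) := div_pos (by linarith) (by linarith)
          linarith
        rw [if_neg (not_le.2 h), if_neg h3, h2]
        congr 1; field_simp; ring
    have key : ∀ s t : unitInterval, (s : ℝ) ≤ t → dist ((γ.trans δ).reparam f hf hf0 hf1 s)
        ((γ.trans δ).reparam f hf hf0 hf1 t) ≤ (L + M) * (t - s) := by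
      intro s t hst
      rw [val, val]
      have h1 : ∀ u v : ℝ, u ≤ v → dist (γ.extend (u / a)) (γ.extend (v / a)) ≤
          (L + M) * (v - u) := fun u v huv => by
        refine (extend_lipschitz hL.le hγ _ _).trans_eq ?_
        rw [← hLa, ← sub_div, abs_div, abs_of_pos ha0, abs_sub_comm, abs_of_nonneg (by linarith)]
        ring
      have h2 : ∀ u v : ℝ, u ≤ v → dist (δ.extend ((u - a) / (1 - a)))
          (δ.extend ((v - a) / (1 - a))) ≤ (L + M) * (v - u) := fun u v huv => by
        refine (extend_lipschitz hM.le hδ _ _).trans_eq ?_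
        rw [← hMa, ← sub_div, abs_div, abs_of_pos ha1, abs_sub_comm, abs_of_nonneg (by linarith)]
        ring
      by_cases hs : (s : ℝ) ≤ a
      · by_cases ht : (t : ℝ) ≤ a
        · rw [if_pos hs, if_pos ht]; exact h1 _ _ hst
        · rw [if_pos hs, if_neg ht]
          have e1 := h1 s a hs
          have e2 := h2 a t (not_le.1 ht).le
          rw [div_self ha0.ne', γ.extend_one] at e1
          rw [sub_self, zero_div, δ.extend_zero] at e2
          calc _ ≤ _ := dist_triangle _ y _
            _ ≤ _ := add_le_add e1 e2
            _ = _ := by ring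
      · have ht : ¬ (t : ℝ) ≤ a := fun h => hs (hst.trans h)
        rw [if_neg hs, if_neg ht]; exact h2 _ _ hst
    intro s t
    rcases le_total (s : ℝ) t with h | h
    · refine (key s t h).trans_eq ?_
      rw [Subtype.dist_eq, Real.dist_eq, abs_sub_comm, abs_of_nonneg (by linarith)]
    · rw [dist_comm]
      refine (key t s h).trans_eq ?_
      rw [Subtype.dist_eq, Real.dist_eq, abs_of_nonneg (by linarith)]
  · rw [← Path.Homotopic.Quotient.mk_trans]
    exact Path.Homotopic.Quotient.eq.2 ⟨(Path.Homotopy.reparam _ f hf hf0 hf1).symm⟩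

theorem subClass {γ : Path x y} {L : ℝ} (hL : HasLipschitzConst L γ) (s t : unitInterval) :
    HasLength (subClass γ s t) (L * dist s t) := by
  refine ⟨γ.subpath s t, fun u v => (hL _ _).trans_eq ?_, rfl⟩
  rw [mul_assoc]
  congr 1
  simp only [Subtype.dist_eq, Real.dist_eq, Set.Icc.coe_convexComb, ← abs_mul]
  rw [← abs_neg]; congr 1; ring

end HasLength

theorem exists_geodesic_path (hgeo : IsGeodesicSpace X) (x y : X) :
    ∃ γ : Path x y, ∀ s t, dist (γ s) (γ t) = dist x y * dist s t := by
  obtain ⟨f, h0, h1, h⟩ := hgeo x y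
  have hI : ∀ t : unitInterval, dist x y * t ∈ Set.Icc (0 : ℝ) (dist x y) := fun t =>
    ⟨mul_nonneg dist_nonneg t.2.1, mul_le_of_le_one_right dist_nonneg t.2.2⟩
  have hd : ∀ s t : unitInterval, dist (f (dist x y * s)) (f (dist x y * t)) =
      dist x y * dist s t := fun s t => by
    rw [h _ (hI s) _ (hI t), ← mul_sub, abs_mul, abs_of_nonneg dist_nonneg]; rfl
  refine ⟨⟨⟨fun t => f (dist x y * t), ?_⟩, by simp [h0], by simp [h1]⟩, hd⟩
  refine (LipschitzWith.of_dist_le_mul (K := ⟨dist x y, dist_nonneg⟩) fun s t => ?_).continuous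
  exact (hd s t).le

/-- A chosen minimizing geodesic from `x` to `y`. -/
noncomputable def geoPath (hgeo : IsGeodesicSpace X) (x y : X) : Path x y :=
  (exists_geodesic_path hgeo x y).choose

theorem dist_geoPath (hgeo : IsGeodesicSpace X) (x y : X) (s t : unitInterval) :
    dist (geoPath hgeo x y s) (geoPath hgeo x y t) = dist x y * dist s t :=
  (exists_geodesic_path hgeo x y).choose_spec s t

theorem dist_left_geoPath_le (hgeo : IsGeodesicSpace X) (x y : X) (t : unitInterval) :
    dist x (geoPath hgeo x y t) ≤ dist x y := by
  have := dist_geoPath hgeo x y 0 t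
  rw [Path.source] at this
  rw [this]
  refine mul_le_of_le_one_right dist_nonneg ?_
  rw [Subtype.dist_eq, Real.dist_eq]
  simpa [abs_of_nonneg t.2.1] using t.2.2

/-- The class of a chosen minimizing geodesic from `x` to `y`. -/
noncomputable def geoClass (hgeo : IsGeodesicSpace X) (x y : X) : PathClass x y :=
  Path.Homotopic.Quotient.mk (geoPath hgeo x y)

theorem hasLength_geoClass (hgeo : IsGeodesicSpace X) (x y : X) :
    HasLength (geoClass hgeo x y) (dist x y) :=
  ⟨geoPath hgeo x y, fun s t => (dist_geoPath hgeo x y s t).le, rfl⟩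

theorem geoClass_self (hgeo : IsGeodesicSpace X) (x : X) :
    geoClass hgeo x x = Path.Homotopic.Quotient.refl x := by
  have := hasLength_geoClass hgeo x x
  rw [dist_self] at this
  obtain ⟨_, h⟩ := this.eq_refl
  simpa using h

/-- Two paths with the same endpoints, both in some ball of radius `R`, are homotopic. -/
def IsSmallRadius (X : Type*) [MetricSpace X] (R : ℝ) : Prop :=
  0 < R ∧ ∀ (z : X) {x y : X} (γ γ' : Path x y), (∀ t, dist z (γ t) < R) →
    (∀ t, dist z (γ' t) < R) → Path.Homotopic.Quotient.mk γ = Path.Homotopic.Quotient.mk γ'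

theorem forall_trans {Y : Type*} [TopologicalSpace Y] {x y z : Y} {γ : Path x y} {δ : Path y z}
    {P : Y → Prop} (h1 : ∀ t, P (γ t)) (h2 : ∀ t, P (δ t)) (t : unitInterval) :
    P (γ.trans δ t) := by
  have : γ.trans δ t ∈ Set.range γ ∪ Set.range δ := by
    rw [← Path.trans_range]; exact ⟨t, rfl⟩
  rcases this with ⟨s, hs⟩ | ⟨s, hs⟩
  · rw [← hs]; exact h1 s
  · rw [← hs]; exact h2 s

/-- A Lebesgue number for the balls supplied by semi-local simple connectivity. -/
theorem exists_isSmallRadius [CompactSpace X] (hgeo : IsGeodesicSpace X) (hslsc : IsSLSC X) :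
    ∃ R, IsSmallRadius X R := by
  have h1 : ∀ x : X, ∃ ε > 0, ∀ γ : Path x x, Set.range γ ⊆ Metric.ball x ε →
      γ.Homotopic (Path.refl x) := fun x => by
    obtain ⟨U, hU, h⟩ := hslsc.2 x
    obtain ⟨ε, hε, hb⟩ := Metric.mem_nhds_iff.1 hU
    exact ⟨ε, hε, fun γ hγ => h γ (hγ.trans hb)⟩
  choose ε hε h using h1
  obtain ⟨R, hR, hcov⟩ := lebesgue_number_lemma_of_metric (isCompact_univ (X := X))
    (c := fun x => Metric.ball x (ε x)) (fun x => Metric.isOpen_ball)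
    (fun x _ => Set.mem_iUnion.2 ⟨x, Metric.mem_ball_self (hε x)⟩)
  refine ⟨R, hR, fun z x y γ γ' hγ hγ' => ?_⟩
  obtain ⟨w, hw⟩ := hcov z trivial
  have hb : ∀ {p : X}, dist z p < R → dist w p < ε w := fun {p} hp => by
    have : p ∈ Metric.ball w (ε w) := hw (by rwa [Metric.mem_ball, dist_comm])
    rwa [Metric.mem_ball, dist_comm] at this
  -- Only loops based at the centre w are known to contract, so the loop at x is conjugated by a
  -- geodesic from w, which stays in the ball.
  let η := geoPath hgeo w x
  have hx : dist w x < ε w := by simpa using hb (hγ 0)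
  have hη : ∀ t, dist w (η t) < ε w := fun t => (dist_left_geoPath_le hgeo w x t).trans_lt hx
  have hη' : ∀ t, dist w (η.symm t) < ε w := fun t => hη _
  have hγ2 : ∀ t, dist w (γ'.symm t) < ε w := fun t => hb (hγ' _)
  have key := h w ((η.trans (γ.trans γ'.symm)).trans η.symm) (by
    rintro _ ⟨t, rfl⟩
    rw [Metric.mem_ball, dist_comm]
    exact forall_trans (P := fun p => dist w p < ε w)
      (forall_trans (P := fun p => dist w p < ε w) hη
        (forall_trans (P := fun p => dist w p < ε w) (fun t => hb (hγ t)) hγ2)) hη' t)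
  have key' := Path.Homotopic.Quotient.eq.2 key
  simp only [Path.Homotopic.Quotient.mk_trans, Path.Homotopic.Quotient.mk_symm,
    Path.Homotopic.Quotient.mk_refl] at key'
  have k2 : (Path.Homotopic.Quotient.mk γ).trans (Path.Homotopic.Quotient.mk γ').symm =
      Path.Homotopic.Quotient.refl x := by
    set e := Path.Homotopic.Quotient.mk η
    calc _ = e.symm.trans (((e.trans ((Path.Homotopic.Quotient.mk γ).trans
          (Path.Homotopic.Quotient.mk γ').symm)).trans e.symm).trans e) := by
          simp [Path.Homotopic.Quotient.trans_assoc, PathClass.symm_trans_trans]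
      _ = _ := by rw [key']; simp
  refine PathClass.trans_right_cancel (r := (Path.Homotopic.Quotient.mk γ').symm) ?_
  rw [k2, Path.Homotopic.Quotient.trans_symm]

theorem IsSmallRadius.geoClass_eq {R : ℝ} (hR : IsSmallRadius X R) (hgeo : IsGeodesicSpace X)
    {x y : X} (γ : Path x y) (h : ∀ t, dist x (γ t) < R) :
    Path.Homotopic.Quotient.mk γ = geoClass hgeo x y := by
  refine hR.2 x _ _ h fun t => (dist_left_geoPath_le hgeo x y t).trans_lt ?_
  simpa using h 1

/-- Uniformly close paths differ by the geodesics that join their endpoints. -/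
theorem IsSmallRadius.trans_geoClass {R : ℝ} (hR : IsSmallRadius X R) (hgeo : IsGeodesicSpace X)
    {x y x' y' : X} (γ : Path x y) (γ' : Path x' y') (h : ∀ t, dist (γ t) (γ' t) < R / 2) :
    (Path.Homotopic.Quotient.mk γ).trans (geoClass hgeo y y') =
      (geoClass hgeo x x').trans (Path.Homotopic.Quotient.mk γ') := by
  have hR2 : 0 < R / 2 := half_pos hR.1
  have main : (subClass γ 0 1).trans (geoClass hgeo (γ 1) (γ' 1)) =
      (geoClass hgeo (γ 0) (γ' 0)).trans (subClass γ' 0 1) := by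
    refine unitInterval_induction (P := fun t => (subClass γ 0 t).trans
      (geoClass hgeo (γ t) (γ' t)) = (geoClass hgeo (γ 0) (γ' 0)).trans (subClass γ' 0 t))
      ?_ fun t => ?_
    · rw [subClass_self, subClass_self]; simp
    · filter_upwards [eventually_subpath_mem γ t (Metric.ball_mem_nhds _ hR2),
        eventually_subpath_mem γ' t (Metric.ball_mem_nhds _ hR2)] with s hs hs'
      have hs2 : ∀ r, dist (γ t) (γ.subpath t s r) < R / 2 := fun r => by
        rw [dist_comm]; exact hs r
      have hs2' : ∀ r, dist (γ' t) (γ'.subpath t s r) < R / 2 := fun r => by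
        rw [dist_comm]; exact hs' r
      -- A thin quadrilateral: all four sides lie in the ball of radius R about γ t.
      have sq : (subClass γ t s).trans (geoClass hgeo (γ s) (γ' s)) =
          (geoClass hgeo (γ t) (γ' t)).trans (subClass γ' t s) := by
        simp only [subClass, geoClass, ← Path.Homotopic.Quotient.mk_trans]
        refine hR.2 (γ t) _ _ (forall_trans (P := fun p => dist (γ t) p < R) ?_ ?_)
          (forall_trans (P := fun p => dist (γ t) p < R) ?_ ?_)
        · intro r; linarith [hs2 r]
        · intro r
          have h1 := hs2 1
          rw [Path.target] at h1
          linarith [dist_triangle (γ t) (γ s) (geoPath hgeo (γ s) (γ' s) r),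
            dist_left_geoPath_le hgeo (γ s) (γ' s) r, h s]
        · intro r
          linarith [dist_left_geoPath_le hgeo (γ t) (γ' t) r, h t]
        · intro r
          linarith [dist_triangle (γ t) (γ' t) (γ'.subpath t s r), hs2' r, h t]
      rw [← subClass_trans γ 0 t s, ← subClass_trans γ' 0 t s, Path.Homotopic.Quotient.trans_assoc,
        sq, ← Path.Homotopic.Quotient.trans_assoc, ← Path.Homotopic.Quotient.trans_assoc]
      exact ⟨fun e => PathClass.trans_right_cancel e, fun e => by rw [e]⟩
  have gen : ∀ {a b a' b' : X} (p : PathClass x y) (p' : PathClass x' y') (ha : a = x) (hb : b = y)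
      (ha' : a' = x') (hb' : b' = y'),
      (p.cast ha hb).trans (geoClass hgeo b b') = (geoClass hgeo a a').trans (p'.cast ha' hb') →
      p.trans (geoClass hgeo y y') = (geoClass hgeo x x').trans p' := by
    intro a b a' b' p p' ha hb ha' hb' e
    subst ha hb ha' hb'
    simpa using e
  rw [subClass_zero_one, subClass_zero_one] at main
  exact gen _ _ _ _ _ _ main

theorem IsSmallRadius.eq_of_close {R : ℝ} (hR : IsSmallRadius X R) (hgeo : IsGeodesicSpace X)
    {x y : X} (γ γ' : Path x y) (h : ∀ t, dist (γ t) (γ' t) < R / 2) :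
    Path.Homotopic.Quotient.mk γ = Path.Homotopic.Quotient.mk γ' := by
  have := hR.trans_geoClass hgeo γ γ' h
  simpa [geoClass_self] using this

theorem IsSmallRadius.map_eq_one_iff {R : ℝ} (hR : IsSmallRadius X R) (hgeo : IsGeodesicSpace X)
    {G : Type*} [Group G] (φ : PathHom X G) {x x' : X} (γ : Path x x) (γ' : Path x' x')
    (h : ∀ t, dist (γ t) (γ' t) < R / 2) :
    φ (Path.Homotopic.Quotient.mk γ) = 1 ↔ φ (Path.Homotopic.Quotient.mk γ') = 1 := by
  have := φ.eq_of_conj (hR.trans_geoClass hgeo γ γ' h)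
  constructor
  · intro e
    rw [e, mul_one] at this
    exact (right_eq_mul.1 this)
  · intro e
    rw [e, one_mul] at this
    exact (mul_eq_left.1 this)

/-- Short pieces of a path are homotopic to geodesics, so rectifiability up to homotopy propagates
along the path. -/
theorem IsSmallRadius.exists_hasLength {R : ℝ} (hR : IsSmallRadius X R) (hgeo : IsGeodesicSpace X)
    {x y : X} (q : PathClass x y) : ∃ L, HasLength q L := by
  obtain ⟨γ, rfl⟩ := Path.Homotopic.Quotient.mk_surjective q
  have main : ∃ L, HasLength (subClass γ 0 1) L := by
    refine unitInterval_induction (P := fun t => ∃ L, HasLength (subClass γ 0 t) L)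
      ⟨0, by rw [subClass_self]; exact .refl _⟩ fun t => ?_
    filter_upwards [eventually_subpath_mem γ t (Metric.ball_mem_nhds _ hR.1)] with s hs
    have e : subClass γ t s = geoClass hgeo (γ t) (γ s) :=
      hR.geoClass_eq hgeo _ fun r => by rw [dist_comm]; exact hs r
    have hl : HasLength (subClass γ t s) (dist (γ t) (γ s)) := by
      rw [e]; exact hasLength_geoClass hgeo _ _
    constructor
    · rintro ⟨L, h⟩
      have := h.trans hl.symm
      rw [← subClass_trans γ 0 t s, Path.Homotopic.Quotient.trans_assoc,
        Path.Homotopic.Quotient.trans_symm, Path.Homotopic.Quotient.trans_refl] at this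
      exact ⟨_, this⟩
    · rintro ⟨L, h⟩
      have := h.trans hl
      rw [subClass_trans] at this
      exact ⟨_, this⟩
  obtain ⟨L, h⟩ := main
  rw [subClass_zero_one] at h
  exact ⟨L, h.of_cast⟩

end Length

/-! ### Shortest representatives and geodesic circles. -/

section Minimizing

variable {X : Type*} [MetricSpace X]

theorem isCompact_setOf_hasLipschitzConst [CompactSpace X] {α : Type*} [MetricSpace α]
    [CompactSpace α] (L : ℝ) : IsCompact {f : C(α, X) | HasLipschitzConst L f} := by
  have h1 : IsCompact {f : BoundedContinuousFunction α X | HasLipschitzConst L f} := by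
    refine BoundedContinuousFunction.arzela_ascoli₁ _ ?_ ?_
    · simp only [HasLipschitzConst, Set.ofPred_forall]
      refine isClosed_iInter fun s => isClosed_iInter fun t => ?_
      exact isClosed_le (by fun_prop) continuous_const
    · refine (Metric.equicontinuous_of_continuity_modulus (fun d => L * d) ?_ _ ?_)
      · have : Continuous fun d : ℝ => L * d := by fun_prop
        simpa using this.tendsto 0
      · exact fun s t f => f.2 s t
  have h2 := h1.image (ContinuousMap.isometryEquivBoundedOfCompact α X).symm.continuous
  have e : {f : C(α, X) | HasLipschitzConst L f} =
      (ContinuousMap.isometryEquivBoundedOfCompact α X).symm ''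
        {f : BoundedContinuousFunction α X | HasLipschitzConst L f} := ?_
  · rw [e]; exact h2
  ext f
  constructor
  · intro h
    exact ⟨BoundedContinuousFunction.mkOfCompact f, h, by ext; rfl⟩
  · rintro ⟨g, hg, rfl⟩
    exact hg

/-- The pairs of a constant at most L and a curve in S obeying it form a compact set, on which the
constant attains its minimum. -/
theorem exists_min_lipschitzConst [CompactSpace X] {α : Type*} [MetricSpace α] [CompactSpace α]
    {S : Set C(α, X)} (hS : IsClosed S) {L : ℝ} (hL : 0 ≤ L) {g : C(α, X)} (hg : g ∈ S)
    (hgL : HasLipschitzConst L g) :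
    ∃ (l : ℝ) (f : C(α, X)), 0 ≤ l ∧ f ∈ S ∧ HasLipschitzConst l f ∧
      ∀ (l' : ℝ) (f' : C(α, X)), 0 ≤ l' → f' ∈ S → HasLipschitzConst l' f' → l ≤ l' := by
  let T : Set (ℝ × C(α, X)) := {p | p.1 ∈ Set.Icc 0 L ∧ p.2 ∈ S ∧ HasLipschitzConst p.1 p.2}
  have hT : IsCompact T := by
    refine ((isCompact_Icc (a := (0 : ℝ)) (b := L)).prod
      (isCompact_setOf_hasLipschitzConst (X := X) (α := α) L)).of_isClosed_subset ?_ ?_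
    · have hc : IsClosed {p : ℝ × C(α, X) | HasLipschitzConst p.1 p.2} := by
        simp only [HasLipschitzConst, Set.ofPred_forall]
        refine isClosed_iInter fun s => isClosed_iInter fun t => ?_
        exact isClosed_le (by fun_prop) (by fun_prop)
      exact (isClosed_Icc.preimage continuous_fst).inter ((hS.preimage continuous_snd).inter hc)
    · rintro ⟨l, f⟩ ⟨hl, -, hf⟩
      exact ⟨hl, fun s t => (hf s t).trans (mul_le_mul_of_nonneg_right hl.2 dist_nonneg)⟩
  obtain ⟨⟨l, f⟩, ⟨hl, hf, hlf⟩, hmin⟩ := hT.exists_isMinOn ⟨(L, g), ⟨hL, le_rfl⟩, hg, hgL⟩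
    continuous_fst.continuousOn
  refine ⟨l, f, hl.1, hf, hlf, fun l' f' hl' hf' hlf' => ?_⟩
  rcases le_total l' L with h | h
  · exact hmin (show (l', f') ∈ T from ⟨⟨hl', h⟩, hf', hlf'⟩)
  · exact hl.2.trans h

theorem unitInterval_dist_of_le {s t : unitInterval} (h : s ≤ t) : dist s t = t - s := by
  have : (s : ℝ) ≤ t := h
  rw [Subtype.dist_eq, Real.dist_eq, abs_sub_comm, abs_of_nonneg (by linarith)]

/-- A shortest representative of a path class. -/
theorem IsSmallRadius.exists_min_path [CompactSpace X] {R : ℝ} (hR : IsSmallRadius X R)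
    (hgeo : IsGeodesicSpace X) {x y : X} (q : PathClass x y) :
    ∃ (l : ℝ) (γ : Path x y), 0 ≤ l ∧ HasLipschitzConst l γ ∧ Path.Homotopic.Quotient.mk γ = q ∧
      ∀ l', HasLength q l' → l ≤ l' := by
  let S : Set C(unitInterval, X) := {f | ∃ γ : Path x y, Path.Homotopic.Quotient.mk γ = q ∧
    γ.toContinuousMap = f}
  have hS : IsClosed S := by
    refine isClosed_of_closure_subset fun f hf => ?_
    have hends : f 0 = x ∧ f 1 = y := by
      have hc : IsClosed {f : C(unitInterval, X) | f 0 = x ∧ f 1 = y} :=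
        (isClosed_eq (by fun_prop) continuous_const).inter (isClosed_eq (by fun_prop)
          continuous_const)
      refine closure_minimal ?_ hc hf
      rintro _ ⟨γ, -, rfl⟩
      exact ⟨γ.source, γ.target⟩
    obtain ⟨_, ⟨γ, hγ, rfl⟩, hd⟩ := Metric.mem_closure_iff.1 hf (R / 2) (half_pos hR.1)
    refine ⟨⟨f, hends.1, hends.2⟩, ?_, rfl⟩
    rw [← hγ]
    exact hR.eq_of_close hgeo _ _ fun t => (ContinuousMap.dist_apply_le_dist t).trans_lt hd
  obtain ⟨L, hL⟩ := hR.exists_hasLength hgeo q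
  have hL0 := hL.nonneg
  obtain ⟨γ₀, h₀, h₀'⟩ := hL
  obtain ⟨l, _, hl, ⟨γ, hγ, rfl⟩, hlip, hmin⟩ :=
    exists_min_lipschitzConst hS hL0 (g := γ₀.toContinuousMap) ⟨γ₀, h₀', rfl⟩ h₀
  refine ⟨l, γ, hl, hlip, hγ, fun l' h' => ?_⟩
  have := h'.nonneg
  obtain ⟨γ', h1, h2⟩ := h'
  exact hmin l' γ'.toContinuousMap this ⟨γ', h2, rfl⟩ h1

/-- Every path class contains a local geodesic. -/
theorem IsSmallRadius.exists_isLocalGeodesic [CompactSpace X] {R : ℝ} (hR : IsSmallRadius X R)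
    (hgeo : IsGeodesicSpace X) {x y : X} (q : PathClass x y) :
    ∃ γ : Path x y, Path.Homotopic.Quotient.mk γ = q ∧ IsLocalGeodesic γ := by
  obtain ⟨l, γ, hl, hlip, rfl, hmin⟩ := hR.exists_min_path hgeo q
  -- Pieces of γ on parameter intervals below R / (l + 1) have length below R, hence are homotopic
  -- to geodesics, which cannot be shorter by minimality. The summand 1 covers l = 0.
  refine ⟨γ, rfl, l, hl, R / (l + 1), div_pos hR.1 (by linarith), ?_⟩
  have key : ∀ s t : unitInterval, s ≤ t → dist s t < R / (l + 1) →
      dist (γ s) (γ t) = l * dist s t := by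
    intro s t hst hd
    refine le_antisymm (hlip s t) (le_of_not_gt fun hlt => ?_)
    have hsmall : l * dist s t < R := by
      rw [lt_div_iff₀ (by linarith)] at hd
      nlinarith [dist_nonneg (x := s) (y := t)]
    have e : subClass γ s t = geoClass hgeo (γ s) (γ t) := by
      refine hR.geoClass_eq hgeo _ fun r => ?_
      have hr : γ.subpath s t r ∈ Set.range (γ.subpath s t) := ⟨r, rfl⟩
      rw [Path.range_subpath_of_le γ s t hst] at hr
      obtain ⟨u, hu, hur⟩ := hr
      rw [← hur]
      refine ((hlip s u).trans (mul_le_mul_of_nonneg_left ?_ hl)).trans_lt hsmall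
      rw [unitInterval_dist_of_le hst, unitInterval_dist_of_le hu.1]
      have : (u : ℝ) ≤ t := hu.2
      linarith
    have h1 : HasLength (((subClass γ 0 s).trans (geoClass hgeo (γ s) (γ t))).trans
        (subClass γ t 1)) _ :=
      ((HasLength.subClass hlip 0 s).trans (hasLength_geoClass hgeo _ _)).trans
        (HasLength.subClass hlip t 1)
    rw [← e, subClass_trans, subClass_trans, subClass_zero_one] at h1
    have h2 := hmin _ h1.of_cast
    rw [unitInterval_dist_of_le hst] at hlt
    rw [unitInterval_dist_of_le s.2.1, unitInterval_dist_of_le t.2.2] at h2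
    simp only [Set.Icc.coe_zero, Set.Icc.coe_one] at h2
    nlinarith
  intro s t hd
  rcases le_total s t with h | h
  · exact key s t h hd
  · rw [dist_comm, dist_comm s t]
    exact key t s h (by rwa [dist_comm])

/-! ### Closed curves as maps on the circle -/

theorem unitAddCircle_dist {s t : ℝ} (h0 : s ≤ t) (h1 : t - s ≤ 1) :
    dist (s : UnitAddCircle) t = min (t - s) (1 - (t - s)) := by
  rw [dist_comm, dist_eq_norm, ← AddCircle.coe_sub, UnitAddCircle.norm_eq, abs_sub_round_eq_min]
  rcases h1.lt_or_eq with h | h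
  · rw [Int.fract_eq_self.2 ⟨by linarith, h⟩]
  · rw [h]; simp

theorem exists_unitInterval_coe_eq (z : UnitAddCircle) :
    ∃ t : unitInterval, ((t : ℝ) : UnitAddCircle) = z := by
  have : z ∈ ((↑) : ℝ → UnitAddCircle) '' Set.Ico 0 (0 + 1) := by
    rw [AddCircle.coe_image_Ico_eq]; trivial
  obtain ⟨t, ht, rfl⟩ := this
  exact ⟨⟨t, ht.1, by linarith [ht.2]⟩, rfl⟩

/-- The closed curve on the circle defined by a loop. -/
noncomputable def circleOfLoop {Y : Type*} [TopologicalSpace Y] {x : Y} (γ : Path x x) :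
    C(UnitAddCircle, Y) where
  toFun := AddCircle.liftIco 1 0 γ.extend
  continuous_toFun := AddCircle.liftIco_zero_continuous (by simp) γ.continuous_extend.continuousOn

theorem circleOfLoop_coe {Y : Type*} [TopologicalSpace Y] {x : Y} (γ : Path x x)
    (t : unitInterval) : circleOfLoop γ ((t : ℝ) : UnitAddCircle) = γ t := by
  rcases eq_or_lt_of_le t.2.2 with h | h
  · have ht : t = 1 := Subtype.ext h
    have : (((1 : unitInterval) : ℝ) : UnitAddCircle) = ((0 : ℝ) : UnitAddCircle) := by
      simp [AddCircle.coe_period]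
    rw [ht, this, γ.target]
    refine (AddCircle.liftIco_zero_coe_apply (p := (1 : ℝ)) (f := γ.extend)
      ⟨le_rfl, one_pos⟩).trans ?_
    simp
  · refine (AddCircle.liftIco_zero_coe_apply (p := (1 : ℝ)) (f := γ.extend) ⟨t.2.1, h⟩).trans ?_
    exact γ.extend_apply t.2

theorem circleLoop_circleOfLoop {Y : Type*} [TopologicalSpace Y] {x : Y} (γ : Path x x)
    (h : circleOfLoop γ 0 = x) : circleLoop (circleOfLoop γ) = γ.cast h h := by
  ext t
  exact circleOfLoop_coe γ t

theorem circleOfLoop_zero {Y : Type*} [TopologicalSpace Y] {x : Y} (γ : Path x x) :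
    circleOfLoop γ 0 = x := by
  have := circleOfLoop_coe γ 0
  simpa using this

theorem hasLength_circleLoop {l : ℝ} {c : C(UnitAddCircle, X)} (h : IsGeodesicCircle l c) :
    HasLength (Path.Homotopic.Quotient.mk (circleLoop c)) l := by
  refine ⟨circleLoop c, ?_, rfl⟩
  have key : ∀ s t : unitInterval, s ≤ t → dist (circleLoop c s) (circleLoop c t) ≤ l * dist s t := by
    intro s t hst
    refine (h.2 _ _).trans_le (mul_le_mul_of_nonneg_left ?_ h.1.le)
    have : (s : ℝ) ≤ t := hst
    rw [unitAddCircle_dist this (by linarith [s.2.1, t.2.2]), unitInterval_dist_of_le hst]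
    exact min_le_left _ _
  intro s t
  rcases le_total s t with hst | hst
  · exact key s t hst
  · rw [dist_comm, dist_comm s t]; exact key t s hst

/-- If a functional on path classes is non-trivial on a loop of length at most `L`, then it is
non-trivial on a geodesic circle of length at most `L`. -/
theorem IsSmallRadius.exists_isGeodesicCircle [CompactSpace X] {R : ℝ} (hR : IsSmallRadius X R)
    (hgeo : IsGeodesicSpace X) {G : Type*} [Group G] (φ : PathHom X G) {x : X} {q : PathClass x x}
    {L : ℝ} (hq : HasLength q L) (hφ : φ q ≠ 1) :
    ∃ (l : ℝ) (c : C(UnitAddCircle, X)), IsGeodesicCircle l c ∧ l ≤ L ∧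
      φ (Path.Homotopic.Quotient.mk (circleLoop c)) ≠ 1 := by
  -- The base point is left free: the minimization is over closed curves, and it is free homotopy
  -- that makes S closed.
  let S : Set C(unitInterval, X) := {f | ∃ (x : X) (γ : Path x x),
    φ (Path.Homotopic.Quotient.mk γ) ≠ 1 ∧ γ.toContinuousMap = f}
  have hS : IsClosed S := by
    refine isClosed_of_closure_subset fun f hf => ?_
    have hends : f 0 = f 1 := by
      have hc : IsClosed {f : C(unitInterval, X) | f 0 = f 1} :=
        isClosed_eq (by fun_prop) (by fun_prop)
      refine closure_minimal ?_ hc hf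
      rintro _ ⟨x, γ, -, rfl⟩
      exact γ.source.trans γ.target.symm
    obtain ⟨_, ⟨x, γ, hγ, rfl⟩, hd⟩ := Metric.mem_closure_iff.1 hf (R / 2) (half_pos hR.1)
    refine ⟨f 0, ⟨f, rfl, hends.symm⟩, ?_, rfl⟩
    refine fun h => hγ ((hR.map_eq_one_iff hgeo φ _ γ fun t => ?_).1 h)
    exact (ContinuousMap.dist_apply_le_dist t).trans_lt hd
  have hL0 := hq.nonneg
  obtain ⟨γ₀, h₀, rfl⟩ := hq
  obtain ⟨l, _, hl, ⟨x, γ, hγ, rfl⟩, hlip, hmin⟩ :=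
    exists_min_lipschitzConst hS hL0 (g := γ₀.toContinuousMap) ⟨_, γ₀, hφ, rfl⟩ h₀
  have hlip' : HasLipschitzConst l γ := hlip
  have hshort : ∀ {z : X} {q : PathClass z z} {l' : ℝ}, HasLength q l' → l' < l → φ q = 1 := by
    intro z q l' h hl'
    by_contra hne
    have := h.nonneg
    obtain ⟨δ, h1, rfl⟩ := h
    exact absurd (hmin l' δ.toContinuousMap this ⟨_, δ, hne, rfl⟩ h1) (not_le.2 hl')
  have hlpos : 0 < l := by
    refine lt_of_le_of_ne hl fun h => hγ ?_
    have h0 : HasLength (Path.Homotopic.Quotient.mk γ) 0 := ⟨γ, by rw [h]; exact hlip', rfl⟩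
    obtain ⟨e, h1⟩ := h0.eq_refl
    rw [h1, φ.map_cast, φ.map_refl]
  have key : ∀ s t : unitInterval, s ≤ t →
      dist (γ s) (γ t) = l * min ((t : ℝ) - s) (1 - (t - s)) := by
    intro s t hst
    have hst' : (s : ℝ) ≤ t := hst
    have hs := HasLength.subClass hlip' 0 s
    have ht := HasLength.subClass hlip' t 1
    have hm := HasLength.subClass hlip' s t
    rw [unitInterval_dist_of_le s.2.1] at hs
    rw [unitInterval_dist_of_le t.2.2] at ht
    rw [unitInterval_dist_of_le hst] at hm
    simp only [Set.Icc.coe_zero, Set.Icc.coe_one] at hs ht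
    have hg := hasLength_geoClass hgeo (γ s) (γ t)
    have hcomp : φ (Path.Homotopic.Quotient.mk γ) =
        φ (subClass γ t 1) * (φ (subClass γ s t) * φ (subClass γ 0 s)) := by
      rw [← φ.map_trans, ← φ.map_trans, subClass_trans, subClass_trans, subClass_zero_one,
        φ.map_cast]
    refine le_antisymm ?_ (le_of_not_gt fun hlt => ?_)
    · rw [mul_min_of_nonneg _ _ hl]
      refine le_min hm.dist_le ?_
      have h1 := hs.dist_le
      have h2 := ht.dist_le
      rw [γ.source] at h1
      rw [γ.target] at h2
      have := dist_triangle (γ s) x (γ t)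
      rw [dist_comm (γ s) x, dist_comm x (γ t)] at this
      linarith
    · rw [mul_min_of_nonneg _ _ hl, lt_min_iff] at hlt
      -- If the chord were shorter than both arcs, the arc from s to t closed by the chord, and γ
      -- with that arc replaced by the chord, would be loops shorter than l. The minimum kills both,
      -- hence γ.
      have hA : φ ((subClass γ s t).trans (geoClass hgeo (γ s) (γ t)).symm) = 1 :=
        hshort (hm.trans hg.symm) (by linarith [hlt.2])
      rw [φ.map_trans, φ.map_symm, inv_mul_eq_one] at hA
      have hB : φ ((((subClass γ 0 s).trans (geoClass hgeo (γ s) (γ t))).trans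
          (subClass γ t 1)).cast γ.source.symm γ.target.symm) = 1 :=
        hshort (((hs.trans hg).trans ht).cast _ _) (by linarith [hlt.1])
      rw [φ.map_cast, φ.map_trans, φ.map_trans, hA] at hB
      exact hγ (hcomp.trans hB)
  refine ⟨l, circleOfLoop γ, ⟨hlpos, ?_⟩, hmin L _ hL0 ⟨_, γ₀, hφ, rfl⟩ h₀, ?_⟩
  · have key' : ∀ s t : unitInterval, s ≤ t → dist (circleOfLoop γ ((s : ℝ) : UnitAddCircle))
        (circleOfLoop γ ((t : ℝ) : UnitAddCircle)) =
          l * dist ((s : ℝ) : UnitAddCircle) ((t : ℝ) : UnitAddCircle) := by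
      intro s t hst
      have hst' : (s : ℝ) ≤ t := hst
      rw [circleOfLoop_coe, circleOfLoop_coe, key s t hst,
        unitAddCircle_dist hst' (by linarith [s.2.1, t.2.2])]
    intro z w
    obtain ⟨s, rfl⟩ := exists_unitInterval_coe_eq z
    obtain ⟨t, rfl⟩ := exists_unitInterval_coe_eq w
    rcases le_total s t with h | h
    · exact key' s t h
    · rw [dist_comm, dist_comm ((s : ℝ) : UnitAddCircle)]; exact key' t s h
  · rw [circleLoop_circleOfLoop γ (circleOfLoop_zero γ), Path.Homotopic.Quotient.mk_cast,
      φ.map_cast]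
    exact hγ

end Minimizing

/-! ### Free homotopy and conjugation. -/

section FreeHomotopy

variable {X : Type*} [TopologicalSpace X]

/-- A loop in `C(I, X)` is a free homotopy of closed curves. -/
theorem homotopic_of_loop {f : C(unitInterval, X)} (Γ : Path f f) {c c' : C(UnitAddCircle, X)}
    (hc : ∀ t : unitInterval, c ((t : ℝ) : UnitAddCircle) = Γ t 0)
    (hc' : ∀ t : unitInterval, c' ((t : ℝ) : UnitAddCircle) = Γ t 1) : c.Homotopic c' := by
  refine ⟨⟨⟨fun p => circleOfLoop Γ p.2 p.1, ?_⟩, fun z => ?_, fun z => ?_⟩⟩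
  · have : Continuous fun p : unitInterval × UnitAddCircle => (circleOfLoop Γ p.2, p.1) := by
      fun_prop
    exact continuous_eval.comp this
  · obtain ⟨t, rfl⟩ := exists_unitInterval_coe_eq z
    exact (congrArg (fun g : C(unitInterval, X) => g 0) (circleOfLoop_coe Γ t)).trans (hc t).symm
  · obtain ⟨t, rfl⟩ := exists_unitInterval_coe_eq z
    exact (congrArg (fun g : C(unitInterval, X) => g 1) (circleOfLoop_coe Γ t)).trans (hc' t).symm

theorem circleOfLoop_homotopic {x : X} {γ γ' : Path x x} (h : γ.Homotopic γ') :
    (circleOfLoop γ).Homotopic (circleOfLoop γ') := by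
  obtain ⟨F⟩ := h
  let G : C(unitInterval, C(unitInterval, X)) :=
    ContinuousMap.curry (F.toContinuousMap.comp ContinuousMap.prodSwap)
  have hG : ∀ t s, G t s = F (s, t) := fun t s => rfl
  refine homotopic_of_loop (f := G 0) ⟨G, rfl, ?_⟩ (fun t => ?_) fun t => ?_
  · ext s
    show G 1 s = G 0 s
    rw [hG, hG, F.source, F.target]
  · rw [circleOfLoop_coe]
    exact (F.apply_zero t).symm
  · rw [circleOfLoop_coe]
    exact (F.apply_one t).symm

/-- The tail δ is shortened from its starting point until only a constant path remains. -/
theorem circleOfLoop_conj_homotopic {x y : X} (δ : Path x y) (γ : Path y y) :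
    (circleOfLoop ((δ.trans γ).trans δ.symm)).Homotopic (circleOfLoop γ) := by
  let D : ∀ s : unitInterval, Path (δ s) y := fun s => (δ.subpath s 1).cast rfl δ.target.symm
  have hD : Continuous (fun p : unitInterval × unitInterval => D p.1 p.2) :=
    δ.subpath_continuous_family.comp (by fun_prop : Continuous fun p : unitInterval × unitInterval =>
      (p.1, (1 : unitInterval), p.2))
  have hP : Continuous (fun p : unitInterval × unitInterval =>
      (((D p.1).trans γ).trans (D p.1).symm) p.2) := by
    refine Path.trans_continuous_family (fun s => (D s).trans γ)
      (Path.trans_continuous_family D hD (fun _ => γ) ?_) (fun s => (D s).symm) ?_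
    · exact γ.continuous.comp continuous_snd
    · exact hD.comp (by fun_prop : Continuous fun p : unitInterval × unitInterval =>
        (p.1, unitInterval.symm p.2))
  let G : C(unitInterval, C(unitInterval, X)) :=
    ContinuousMap.curry (ContinuousMap.comp ⟨_, hP⟩ ContinuousMap.prodSwap)
  have hG : ∀ t s, G t s = (((D s).trans γ).trans (D s).symm) t := fun t s => rfl
  have h1 : (circleOfLoop ((δ.trans γ).trans δ.symm)).Homotopic
      (circleOfLoop (((Path.refl y).trans γ).trans (Path.refl y).symm)) := by
    refine homotopic_of_loop (f := G 0) ⟨G, rfl, ?_⟩ (fun t => ?_) fun t => ?_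
    · ext s
      show G 1 s = G 0 s
      rw [hG, hG, Path.source, Path.target]
    · rw [circleOfLoop_coe]
      have : D 0 = δ.cast δ.source rfl := by
        ext u
        simp [D]
      show _ = G t 0
      rw [hG, this]
      rfl
    · rw [circleOfLoop_coe]
      have : D 1 = (Path.refl y).cast δ.target rfl := by
        ext u
        simp [D]
      show _ = G t 1
      rw [hG, this]
      rfl
  refine h1.trans (circleOfLoop_homotopic (Path.Homotopic.Quotient.eq.1 ?_))
  simp only [Path.Homotopic.Quotient.mk_trans, Path.refl_symm, Path.Homotopic.Quotient.mk_refl,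
    Path.Homotopic.Quotient.trans_refl, Path.Homotopic.Quotient.refl_trans]

theorem circleOfLoop_circleLoop (c : C(UnitAddCircle, X)) : circleOfLoop (circleLoop c) = c := by
  ext z
  obtain ⟨t, rfl⟩ := exists_unitInterval_coe_eq z
  rw [circleOfLoop_coe]; rfl

theorem homotopic_of_conj {c c' : C(UnitAddCircle, X)} (δ : Path (c 0) (c' 0))
    (h : (Path.Homotopic.Quotient.mk (circleLoop c)).trans (Path.Homotopic.Quotient.mk δ) =
      (Path.Homotopic.Quotient.mk δ).trans (Path.Homotopic.Quotient.mk (circleLoop c'))) :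
    c.Homotopic c' := by
  have e : Path.Homotopic.Quotient.mk (circleLoop c) =
      Path.Homotopic.Quotient.mk ((δ.trans (circleLoop c')).trans δ.symm) := by
    rw [Path.Homotopic.Quotient.mk_trans, Path.Homotopic.Quotient.mk_trans, ← h,
      Path.Homotopic.Quotient.mk_symm, Path.Homotopic.Quotient.trans_assoc]
    simp
  have := (circleOfLoop_homotopic (Path.Homotopic.Quotient.eq.1 e)).trans
    (circleOfLoop_conj_homotopic δ (circleLoop c'))
  rwa [circleOfLoop_circleLoop, circleOfLoop_circleLoop] at this

/-- The track of the base point conjugates one loop into the other, so their values under φ are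
conjugate. This lets free homotopy classes be separated by functors. -/
theorem PathHom.map_circleLoop_eq_one_iff {G : Type*} [Group G] (φ : PathHom X G)
    {c c' : C(UnitAddCircle, X)} (h : c.Homotopic c') :
    φ (Path.Homotopic.Quotient.mk (circleLoop c)) = 1 ↔
      φ (Path.Homotopic.Quotient.mk (circleLoop c')) = 1 := by
  obtain ⟨F⟩ := h
  have e : (Path.Homotopic.Quotient.mk (circleLoop c)).trans
      (Path.Homotopic.Quotient.mk (F.evalAt 0)) =
      (Path.Homotopic.Quotient.mk (F.evalAt 0)).trans
        (Path.Homotopic.Quotient.mk (circleLoop c')) :=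
    Path.Homotopic.Quotient.eq.2
      (Path.Homotopic.map_trans_evalAt F (circleLoop (ContinuousMap.id UnitAddCircle)))
  have := φ.eq_of_conj e
  constructor
  · intro h
    rw [h, mul_one] at this
    exact right_eq_mul.1 this
  · intro h
    rw [h, one_mul] at this
    exact mul_eq_left.1 this

end FreeHomotopy

/-! ### Finiteness of homotopy classes and generation of the fundamental group. -/

section Finiteness

variable {X : Type*} [MetricSpace X]

theorem IsSmallRadius.homotopic_of_close {R : ℝ} (hR : IsSmallRadius X R)
    (hgeo : IsGeodesicSpace X) {c c' : C(UnitAddCircle, X)} (h : dist c c' < R / 2) :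
    c.Homotopic c' :=
  homotopic_of_conj (geoPath hgeo (c 0) (c' 0))
    (hR.trans_geoClass hgeo (circleLoop c) (circleLoop c') fun _ =>
      (ContinuousMap.dist_apply_le_dist (f := c) (g := c') _).trans_lt h)

/-- Finitely many ε-balls cover K, and g takes on each the value at its centre. -/
theorem IsCompact.finite_image_of_close {Y Q : Type*} [PseudoMetricSpace Y] {K : Set Y}
    (hK : IsCompact K) (g : Y → Q) {ε : ℝ} (hε : 0 < ε)
    (h : ∀ a ∈ K, ∀ b ∈ K, dist a b < ε → g a = g b) : (g '' K).Finite := by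
  obtain ⟨t, htK, ht, hcov⟩ := hK.finite_cover_balls hε
  refine (ht.image g).subset ?_
  rintro _ ⟨a, ha, rfl⟩
  obtain ⟨b, hb, hab⟩ := Set.mem_iUnion₂.1 (hcov ha)
  exact ⟨b, hb, (h a ha b (htK hb) hab).symm⟩

theorem IsGeodesicCircle.length_le [CompactSpace X] {l : ℝ} {c : C(UnitAddCircle, X)}
    (h : IsGeodesicCircle l c) : l ≤ 2 * Metric.diam (Set.univ : Set X) := by
  have h1 := h.2 ((0 : ℝ) : UnitAddCircle) ((1 / 2 : ℝ) : UnitAddCircle)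
  rw [unitAddCircle_dist (by norm_num) (by norm_num)] at h1
  have h2 := Metric.dist_le_diam_of_mem (isCompact_univ (X := X)).isBounded
    (Set.mem_univ (c ((0 : ℝ) : UnitAddCircle))) (Set.mem_univ (c ((1 / 2 : ℝ) : UnitAddCircle)))
  rw [h1] at h2
  norm_num at h2
  linarith

theorem IsSmallRadius.finite_freeHomotopyClass [CompactSpace X] {R : ℝ} (hR : IsSmallRadius X R)
    (hgeo : IsGeodesicSpace X) :
    {C | ∃ (l : ℝ) (c : C(UnitAddCircle, X)),
      IsGeodesicCircle l c ∧ freeHomotopyClass c = C}.Finite := by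
  have h := (isCompact_setOf_hasLipschitzConst (X := X) (α := UnitAddCircle)
    (2 * Metric.diam (Set.univ : Set X))).finite_image_of_close freeHomotopyClass (half_pos hR.1)
    fun a _ b _ hab => Quotient.sound (hR.homotopic_of_close hgeo hab)
  refine h.subset ?_
  rintro _ ⟨l, c, hc, rfl⟩
  refine ⟨c, fun s t => ?_, rfl⟩
  rw [hc.2]
  exact mul_le_mul_of_nonneg_right hc.length_le dist_nonneg

theorem IsSmallRadius.finite_hasLength [CompactSpace X] {R : ℝ} (hR : IsSmallRadius X R)
    (hgeo : IsGeodesicSpace X) (x y : X) (L : ℝ) : {q : PathClass x y | HasLength q L}.Finite := by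
  classical
  have hK : IsCompact {f : C(unitInterval, X) | HasLipschitzConst L f ∧ (f 0 = x ∧ f 1 = y)} :=
    (isCompact_setOf_hasLipschitzConst L).inter_right ((isClosed_eq (by fun_prop)
      continuous_const).inter (isClosed_eq (by fun_prop) continuous_const))
  let g : C(unitInterval, X) → PathClass x y := fun f =>
    if h : f 0 = x ∧ f 1 = y then Path.Homotopic.Quotient.mk ⟨f, h.1, h.2⟩ else geoClass hgeo x y
  refine (hK.finite_image_of_close g (half_pos hR.1) ?_).subset ?_
  · rintro a ⟨-, ha⟩ b ⟨-, hb⟩ hab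
    simp only [g, dif_pos ha, dif_pos hb]
    exact hR.eq_of_close hgeo _ _ fun t => (ContinuousMap.dist_apply_le_dist t).trans_lt hab
  · rintro _ ⟨γ, hγ, rfl⟩
    have h : γ.toContinuousMap 0 = x ∧ γ.toContinuousMap 1 = y := ⟨γ.source, γ.target⟩
    refine ⟨γ.toContinuousMap, ⟨hγ, h⟩, ?_⟩
    simp only [g, dif_pos h]

/-- Loops of bounded length generate the fundamental group. -/
theorem IsSmallRadius.closure_hasLength [CompactSpace X] {R : ℝ} (hR : IsSmallRadius X R)
    (hgeo : IsGeodesicSpace X) (x₀ : X) :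
    Subgroup.closure {q : FundamentalGroup X x₀ |
      HasLength (x := x₀) (y := x₀) q (2 * Metric.diam (Set.univ : Set X) + R)} = ⊤ := by
  set Λ := Subgroup.closure {q : FundamentalGroup X x₀ |
      HasLength (x := x₀) (y := x₀) q (2 * Metric.diam (Set.univ : Set X) + R)} with hΛ
  have hdiam : ∀ a b : X, dist a b ≤ Metric.diam (Set.univ : Set X) := fun a b =>
    Metric.dist_le_diam_of_mem (isCompact_univ (X := X)).isBounded trivial trivial
  rw [eq_top_iff]
  intro q _
  obtain ⟨γ, hγ⟩ := Path.Homotopic.Quotient.mk_surjective (FundamentalGroup.toPath q)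
  -- Closing each short piece of γ by geodesics to the base point writes γ as a product of loops
  -- made of two geodesics of length at most the diameter and a piece shorter than R.
  let conj : ∀ {a b : X}, PathClass a b → FundamentalGroup X x₀ := fun {a b} p =>
    FundamentalGroup.fromPath (((geoClass hgeo x₀ a).trans p).trans (geoClass hgeo x₀ b).symm)
  have conj_trans : ∀ {a b c : X} (p : PathClass a b) (r : PathClass b c),
      conj (p.trans r) = conj r * conj p := fun p r => by
    rw [FundamentalGroup.mul_def]
    simp only [conj, Path.Homotopic.Quotient.trans_assoc, PathClass.symm_trans_trans]
  have main : conj (subClass γ 0 1) ∈ Λ := by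
    refine unitInterval_induction (P := fun t => conj (subClass γ 0 t) ∈ Λ) ?_ fun t => ?_
    · rw [subClass_self]
      have : conj (Path.Homotopic.Quotient.refl (γ 0)) = 1 := by
        simp only [conj, Path.Homotopic.Quotient.trans_refl, Path.Homotopic.Quotient.trans_symm]
        rfl
      rw [this]
      exact one_mem _
    · filter_upwards [eventually_subpath_mem γ t (Metric.ball_mem_nhds _ hR.1)] with s hs
      have hmem : conj (subClass γ t s) ∈ Λ := by
        refine Subgroup.subset_closure ?_
        have e : subClass γ t s = geoClass hgeo (γ t) (γ s) :=
          hR.geoClass_eq hgeo _ fun r => by rw [dist_comm]; exact hs r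
        have hd : dist (γ t) (γ s) < R := by
          have := hs 1
          rw [Path.target, Metric.mem_ball, dist_comm] at this
          exact this
        have hl := ((hasLength_geoClass hgeo x₀ (γ t)).trans
          (hasLength_geoClass hgeo (γ t) (γ s))).trans (hasLength_geoClass hgeo x₀ (γ s)).symm
        rw [← e] at hl
        exact hl.mono (by linarith [hdiam x₀ (γ t), hdiam x₀ (γ s)])
      rw [← subClass_trans γ 0 t s, conj_trans]
      exact Subgroup.mul_mem_cancel_left _ hmem
  have gen : ∀ {a b : X} (ha : a = x₀) (hb : b = x₀) (p : PathClass x₀ x₀),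
      conj (p.cast ha hb) = FundamentalGroup.fromPath p := by
    intro a b ha hb p
    subst ha hb
    have : (Path.Homotopic.Quotient.refl b).symm = Path.Homotopic.Quotient.refl b := by
      rw [← Path.Homotopic.Quotient.mk_refl, ← Path.Homotopic.Quotient.mk_symm, Path.refl_symm]
    simp only [conj, geoClass_self, this, Path.Homotopic.Quotient.trans_refl,
      Path.Homotopic.Quotient.refl_trans, Path.Homotopic.Quotient.cast_rfl_rfl]
  rw [subClass_zero_one, gen, hγ] at main
  exact main

theorem Subgroup.exists_finite_subset_of_mem_closure {G : Type*} [Group G] {S : Set G} {g : G}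
    (hg : g ∈ Subgroup.closure S) : ∃ T ⊆ S, T.Finite ∧ g ∈ Subgroup.closure T := by
  induction hg using Subgroup.closure_induction with
  | mem x hx => exact ⟨{x}, by simpa using hx, Set.finite_singleton x,
      Subgroup.subset_closure rfl⟩
  | one => exact ⟨∅, Set.empty_subset _, Set.finite_empty, one_mem _⟩
  | mul x y _ _ hx hy =>
    obtain ⟨T, hT, hf, hx⟩ := hx
    obtain ⟨T', hT', hf', hy⟩ := hy
    exact ⟨T ∪ T', Set.union_subset hT hT', hf.union hf', mul_mem
      (Subgroup.closure_mono Set.subset_union_left hx)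
      (Subgroup.closure_mono Set.subset_union_right hy)⟩
  | inv x _ hx =>
    obtain ⟨T, hT, hf, hx⟩ := hx
    exact ⟨T, hT, hf, inv_mem hx⟩

theorem Subgroup.exists_finite_subset_closure_eq_top {G : Type*} [Group G] {S B : Set G}
    (hB : B.Finite) (hBtop : Subgroup.closure B = ⊤) (hS : Subgroup.closure S = ⊤) :
    ∃ T ⊆ S, T.Finite ∧ Subgroup.closure T = ⊤ := by
  have h : ∀ b : G, ∃ T ⊆ S, T.Finite ∧ b ∈ Subgroup.closure T := fun b =>
    Subgroup.exists_finite_subset_of_mem_closure (hS ▸ Subgroup.mem_top b)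
  choose T hTS hTf hT using h
  refine ⟨⋃ b ∈ B, T b, Set.iUnion₂_subset fun b _ => hTS b, hB.biUnion fun b _ => hTf b, ?_⟩
  rw [eq_top_iff, ← hBtop, Subgroup.closure_le]
  exact fun b hb => Subgroup.closure_mono (Set.subset_biUnion_of_mem hb) (hT b)

/-- The tail of a lasso is no restriction: every path class contains a local geodesic. -/
theorem IsSmallRadius.mem_geodesicLassoClasses [CompactSpace X] {R : ℝ} (hR : IsSmallRadius X R)
    (hgeo : IsGeodesicSpace X) {x₀ : X} {l : ℝ} {c : C(UnitAddCircle, X)}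
    (hc : IsGeodesicCircle l c) (q : PathClass x₀ (c 0)) :
    FundamentalGroup.fromPath ((q.trans (Path.Homotopic.Quotient.mk (circleLoop c))).trans q.symm) ∈
      geodesicLassoClasses x₀ := by
  obtain ⟨α, rfl, hα⟩ := hR.exists_isLocalGeodesic hgeo q
  exact ⟨l, c, α, hc, hα, rfl⟩

/-- Geodesic lassos generate the fundamental group. -/
theorem IsSmallRadius.closure_geodesicLassoClasses [CompactSpace X] {R : ℝ}
    (hR : IsSmallRadius X R) (hgeo : IsGeodesicSpace X) [PathConnectedSpace X] (x₀ : X) :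
    Subgroup.closure (geodesicLassoClasses x₀) = ⊤ := by
  -- A conjugating loop can be absorbed into the tail of the lasso.
  have hconj : Group.conjugatesOfSet (geodesicLassoClasses x₀) ⊆ geodesicLassoClasses x₀ := by
    intro a ha
    obtain ⟨b, ⟨l, c, α, hc, -, rfl⟩, hab⟩ := Group.mem_conjugatesOfSet_iff.1 ha
    obtain ⟨g, rfl⟩ := isConj_iff.1 hab
    have := hR.mem_geodesicLassoClasses hgeo hc
      ((FundamentalGroup.toPath g).symm.trans (Path.Homotopic.Quotient.mk α))
    convert this using 1
    rw [FundamentalGroup.mul_def, FundamentalGroup.mul_def, FundamentalGroup.inv_def,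
      PathClass.symm_trans_rev, PathClass.symm_symm]
    simp only [Path.Homotopic.Quotient.mk_trans, Path.Homotopic.Quotient.mk_symm,
      Path.Homotopic.Quotient.trans_assoc]
  have hcl : Subgroup.normalClosure (geodesicLassoClasses x₀) =
      Subgroup.closure (geodesicLassoClasses x₀) :=
    le_antisymm (Subgroup.closure_mono hconj) Subgroup.closure_le_normalClosure
  rw [← hcl, eq_top_iff]
  intro g _
  by_contra hg
  let φ := (PathHom.retract X x₀).postcomp
    (QuotientGroup.mk' (Subgroup.normalClosure (geodesicLassoClasses x₀)))
  have hφ : ∀ {x : X} (p : PathClass x x), φ p = 1 ↔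
      PathHom.retract X x₀ p ∈ Subgroup.normalClosure (geodesicLassoClasses x₀) :=
    fun p => QuotientGroup.eq_one_iff _
  have h1 : φ (FundamentalGroup.toPath g) ≠ 1 := by
    rw [Ne, hφ]
    intro h
    -- The path chosen from the base point to itself need not be constant, so the retraction
    -- conjugates by τ; normality absorbs this.
    let τ : FundamentalGroup X x₀ := FundamentalGroup.fromPath
      (Path.Homotopic.Quotient.mk (PathConnectedSpace.somePath x₀ x₀))
    have e : PathHom.retract X x₀ (FundamentalGroup.toPath g) = τ⁻¹ * (g * τ) := rfl
    rw [e] at h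
    have := Subgroup.normalClosure_normal.mem_comm h
    rw [mul_inv_cancel_right] at this
    exact hg this
  obtain ⟨L, hL⟩ := hR.exists_hasLength hgeo (FundamentalGroup.toPath g)
  obtain ⟨l, c, hc, -, hne⟩ := hR.exists_isGeodesicCircle hgeo φ hL h1
  rw [Ne, hφ] at hne
  exact hne (Subgroup.subset_normalClosure (hR.mem_geodesicLassoClasses hgeo hc
    (Path.Homotopic.Quotient.mk (PathConnectedSpace.somePath x₀ (c 0)))))

end Finiteness

/-! ### The action of paths of X on Rips groups, and bonding maps. -/

section Rips

open GeomRealization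

variable {X : Type*} [MetricSpace X] {r : ℝ} (hr : 0 < r)

theorem mem_ripsComplex_faces {σ : Finset X} (hσ : σ.Nonempty)
    (h : ∀ a ∈ σ, ∀ b ∈ σ, dist a b < r) : σ ∈ (ripsComplex X r hr).faces := by
  refine ⟨hσ, ?_⟩
  obtain ⟨⟨a, b⟩, hab, hmax⟩ := Finset.exists_max_image (σ ×ˢ σ) (fun p => dist p.1 p.2)
    (hσ.product hσ)
  rw [Finset.mem_product] at hab
  refine lt_of_le_of_lt ?_ (h a hab.1 b hab.2)
  exact Metric.diam_le_of_forall_dist_le dist_nonneg fun x hx y hy =>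
    hmax (x, y) (Finset.mem_product.2 ⟨hx, hy⟩)

theorem dist_lt_of_mem_face {hr : 0 < r} (σ : (ripsComplex X r hr).faces) {a b : X} (ha : a ∈ σ.1)
    (hb : b ∈ σ.1) : dist a b < r :=
  lt_of_le_of_lt (Metric.dist_le_diam_of_mem σ.1.finite_toSet.isBounded ha hb) σ.2.2

theorem exists_ripsComplex_face {x y z : X} (hxy : dist x y < r) (hyz : dist y z < r)
    (hxz : dist x z < r) : ∃ σ : (ripsComplex X r hr).faces, x ∈ σ.1 ∧ y ∈ σ.1 ∧ z ∈ σ.1 := by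
  classical
  refine ⟨⟨{x, y, z}, mem_ripsComplex_faces hr (by simp) ?_⟩, by simp, by simp, by simp⟩
  intro a ha b hb
  simp only [Finset.mem_insert, Finset.mem_singleton] at ha hb
  rcases ha with rfl | rfl | rfl <;> rcases hb with rfl | rfl | rfl <;>
    first | assumption | (rw [dist_comm]; assumption) | (rw [dist_self]; assumption)

theorem ripsComplex_adjacent {x y : X} (h : dist x y < r) : Adjacent (ripsComplex X r hr) x y := by
  obtain ⟨σ, hx, hy, -⟩ := exists_ripsComplex_face hr h (z := y) (by simpa using hr) h
  exact .intro σ hx hy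

theorem GeomRealization.Adjacent.dist_lt {hr : 0 < r} {x y : X}
    (h : Adjacent (ripsComplex X r hr) x y) : dist x y < r := by
  obtain ⟨σ, hx, hy⟩ := h
  exact dist_lt_of_mem_face σ hx hy

theorem ripsComplex_edge_trans {x y z : X} (hxy : dist x y < r) (hyz : dist y z < r)
    (hxz : dist x z < r) :
    (edge (ripsComplex_adjacent hr hxy)).trans (edge (ripsComplex_adjacent hr hyz)) =
      edge (ripsComplex_adjacent hr hxz) := by
  obtain ⟨σ, hx, hy, hz⟩ := exists_ripsComplex_face hr hxy hyz hxz
  exact edge_trans σ hx hy hz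

theorem pathConnectedSpace_ripsComplex (hgeo : IsGeodesicSpace X) [Nonempty X] :
    PathConnectedSpace (GeomRealization (ripsComplex X r hr)) := by
  have hv : ∀ x y : X, Joined (vertex (ripsComplex X r hr) x) (vertex (ripsComplex X r hr) y) := by
    intro x y
    let γ := geoPath hgeo x y
    have : Joined (vertex (ripsComplex X r hr) x) (vertex (ripsComplex X r hr) (γ 1)) := by
      refine unitInterval_induction (P := fun t =>
        Joined (vertex (ripsComplex X r hr) x) (vertex (ripsComplex X r hr) (γ t))) ?_ fun t => ?_
      · rw [γ.source]
      · filter_upwards [γ.continuous.continuousAt.preimage_mem_nhds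
          (Metric.ball_mem_nhds (γ t) hr)] with s hs
        have hj := (ripsComplex_adjacent hr (show dist (γ s) (γ t) < r from hs)).joined
        exact ⟨fun h => h.trans hj, fun h => h.trans hj.symm⟩
    rwa [γ.target] at this
  refine ⟨⟨vertex _ (Classical.arbitrary X)⟩, fun p q => ?_⟩
  obtain ⟨v, hp⟩ := exists_mem_openStar p
  obtain ⟨w, hq⟩ := exists_mem_openStar q
  exact (joined_vertex hp).trans ((hv v w).trans (joined_vertex hq).symm)

/-- The group `π₁(Rips(X, r), x₀)`. -/
abbrev RipsGroup (x₀ : X) : Type _ :=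
  FundamentalGroup (GeomRealization (ripsComplex X r hr)) (vertex (ripsComplex X r hr) x₀)

variable (hgeo : IsGeodesicSpace X) (x₀ : X)

/-- The fundamental groupoid of the Rips complex, acting on its fundamental group. -/
noncomputable def ripsPerm : PathHom (GeomRealization (ripsComplex X r hr))
    (Equiv.Perm (RipsGroup hr x₀)) :=
  have : Nonempty X := ⟨x₀⟩
  have := pathConnectedSpace_ripsComplex hr hgeo
  (PathHom.retract _ (vertex (ripsComplex X r hr) x₀)).postcomp
    (MulAction.toPermHom (RipsGroup hr x₀) (RipsGroup hr x₀))

/-- The action is by left multiplication, which is faithful; permutations are used because they are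
the values of monodromy. -/
theorem ripsPerm_eq_one_iff {p : GeomRealization (ripsComplex X r hr)} (q : PathClass p p) :
    ripsPerm hr hgeo x₀ q = 1 ↔ q = Path.Homotopic.Quotient.refl p := by
  have : Nonempty X := ⟨x₀⟩
  have := pathConnectedSpace_ripsComplex hr hgeo
  rw [← PathHom.retract_eq_one_iff (vertex (ripsComplex X r hr) x₀) q]
  exact map_eq_one_iff _ MulAction.toPerm_injective

open Classical in
/-- The cocycle on `X` defined by the edges of the Rips complex. -/
noncomputable def ripsCocycle (x y : X) : Equiv.Perm (RipsGroup hr x₀) :=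
  if h : dist x y < r then ripsPerm hr hgeo x₀ (edge (ripsComplex_adjacent hr h)) else 1

theorem ripsCocycle_of_lt {x y : X} (h : dist x y < r) :
    ripsCocycle hr hgeo x₀ x y = ripsPerm hr hgeo x₀ (edge (ripsComplex_adjacent hr h)) :=
  dif_pos h

theorem ripsCocycle_mul {x y z : X} (hxy : dist x y < r) (hyz : dist y z < r)
    (hxz : dist x z < r) :
    ripsCocycle hr hgeo x₀ y z * ripsCocycle hr hgeo x₀ x y = ripsCocycle hr hgeo x₀ x z := by
  rw [ripsCocycle_of_lt _ _ _ hxy, ripsCocycle_of_lt _ _ _ hyz, ripsCocycle_of_lt _ _ _ hxz,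
    ← PathHom.map_trans, ripsComplex_edge_trans hr hxy hyz hxz]

theorem ripsCocycle_self (x : X) : ripsCocycle hr hgeo x₀ x x = 1 := by
  have h : dist x x < r := by simpa using hr
  exact mul_eq_left.1 (ripsCocycle_mul hr hgeo x₀ h h h)

/-- Balls of radius r / 2 that meet have centres at distance less than r, so edges form a cocycle
for this cover. A path of length below r lies in the ball about its midpoint, so its monodromy is
that of the edge between its endpoints. -/
theorem exists_ripsTheta : ∃ θ : PathHom X (Equiv.Perm (RipsGroup hr x₀)),
    ∀ {x y : X} {q : PathClass x y} {L : ℝ}, HasLength q L → L < r →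
      θ q = ripsCocycle hr hgeo x₀ x y := by
  have htri : ∀ {x y w : X}, w ∈ Metric.ball x (r / 2) → w ∈ Metric.ball y (r / 2) →
      dist x y < r := fun {x y w} hx hy => by
    rw [Metric.mem_ball] at hx hy
    linarith [dist_triangle_left x y w]
  obtain ⟨θ, hθ⟩ := exists_monodromy (fun x : X => Metric.ball x (r / 2))
    (fun x => Metric.isOpen_ball) id (fun x => Metric.mem_ball_self (half_pos hr))
    (ripsCocycle hr hgeo x₀) fun i j k ⟨w, ⟨hi, hj⟩, hk⟩ =>
      ripsCocycle_mul hr hgeo x₀ (htri hi hj) (htri hj hk) (htri hi hk)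
  refine ⟨θ, fun {x y q L} hq hL => ?_⟩
  have hd := hq.dist_le
  have hL0 := hq.nonneg
  obtain ⟨γ, hγ, rfl⟩ := hq
  let h : unitInterval := ⟨1 / 2, by norm_num, by norm_num⟩
  have hball : ∀ t, dist (γ t) (γ h) ≤ L / 2 := fun t => by
    refine (hγ t h).trans ?_
    have : dist t h ≤ 1 / 2 := by
      rw [Subtype.dist_eq, Real.dist_eq, abs_le]
      constructor <;> linarith [t.2.1, t.2.2, show (h : ℝ) = 1 / 2 from rfl]
    nlinarith
  have hx := hball 0
  have hy := hball 1
  rw [γ.source] at hx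
  rw [γ.target, dist_comm] at hy
  rw [hθ (γ h) γ fun t => (hball t).trans_lt (by linarith)]
  exact ripsCocycle_mul hr hgeo x₀ (show dist x (γ h) < r by linarith)
    (show dist (γ h) y < r by linarith) (hd.trans_lt hL)

/-- The action of paths of `X` on the fundamental group of the Rips complex. -/
noncomputable def ripsTheta : PathHom X (Equiv.Perm (RipsGroup hr x₀)) :=
  (exists_ripsTheta hr hgeo x₀).choose

theorem ripsTheta_of_hasLength {x y : X} {q : PathClass x y} {L : ℝ} (hq : HasLength q L)
    (hL : L < r) : ripsTheta hr hgeo x₀ q = ripsCocycle hr hgeo x₀ x y :=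
  (exists_ripsTheta hr hgeo x₀).choose_spec hq hL

/-- Loops of length less than `3 r` act trivially. -/
theorem ripsTheta_eq_one {x : X} {q : PathClass x x} {L : ℝ} (hq : HasLength q L)
    (hL : L < 3 * r) : ripsTheta hr hgeo x₀ q = 1 := by
  obtain ⟨γ, hγ, rfl⟩ := hq
  -- Each third of the loop has length below r, and the three division points span a simplex.
  let a : unitInterval := ⟨1 / 3, by norm_num, by norm_num⟩
  let b : unitInterval := ⟨2 / 3, by norm_num, by norm_num⟩
  have h0a : L * dist 0 a < r := by
    have : dist 0 a = 1 / 3 := by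
      rw [Subtype.dist_eq, Real.dist_eq]
      norm_num [a]
    rw [this]; linarith
  have hab : L * dist a b < r := by
    have : dist a b = 1 / 3 := by
      rw [Subtype.dist_eq, Real.dist_eq, abs_sub_comm]
      norm_num [a, b]
    rw [this]; linarith
  have hb1 : L * dist b 1 < r := by
    have : dist b 1 = 1 / 3 := by
      rw [Subtype.dist_eq, Real.dist_eq, abs_sub_comm]
      norm_num [b]
    rw [this]; linarith
  have hcomp : ripsTheta hr hgeo x₀ (Path.Homotopic.Quotient.mk γ) =
      ripsTheta hr hgeo x₀ (subClass γ b 1) * (ripsTheta hr hgeo x₀ (subClass γ a b) *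
        ripsTheta hr hgeo x₀ (subClass γ 0 a)) := by
    rw [← PathHom.map_trans, ← PathHom.map_trans, subClass_trans, subClass_trans,
      subClass_zero_one, PathHom.map_cast]
  have e : γ 1 = γ 0 := γ.target.trans γ.source.symm
  have d0a := (hγ 0 a).trans_lt h0a
  have dab := (hγ a b).trans_lt hab
  have db1 := (hγ b 1).trans_lt hb1
  rw [hcomp, ripsTheta_of_hasLength hr hgeo x₀ (HasLength.subClass hγ b 1) hb1,
    ripsTheta_of_hasLength hr hgeo x₀ (HasLength.subClass hγ a b) hab,
    ripsTheta_of_hasLength hr hgeo x₀ (HasLength.subClass hγ 0 a) h0a, e]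
  rw [e] at db1
  rw [ripsCocycle_mul hr hgeo x₀ d0a dab (by rwa [dist_comm]),
    ripsCocycle_mul hr hgeo x₀ (by rwa [dist_comm]) db1 (by simpa using hr), ripsCocycle_self]

theorem ripsPi1Map_apply {p q : ℝ} (hp : 0 < p) (hq : 0 < q) (hpq : p ≤ q)
    (a : RipsGroup hp x₀) : ripsPi1Map x₀ p q hp hq hpq a =
      Path.Homotopic.Quotient.map (FundamentalGroup.toPath a)
        (inclusion (ripsComplex_faces_mono X hp hq hpq)) := by
  rw [ripsPi1Map, FundamentalGroup.mapOfEq_apply]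
  exact Path.Homotopic.Quotient.cast_rfl_rfl _

/-- An edge of the larger complex is subdivided along a geodesic. All points of the geodesic stay
within q of its origin, so the subdivided edge is filled by triangles at scale q, while its small
steps are edges at scale p. -/
theorem ripsPi1Map_surjective (hgeo : IsGeodesicSpace X) (x₀ : X) {p q : ℝ} (hp : 0 < p) (hq : 0 < q) (hpq : p ≤ q) :
    Function.Surjective (ripsPi1Map x₀ p q hp hq hpq) := by
  let i := inclusion (ripsComplex_faces_mono X hp hq hpq)
  let Lifts : ∀ {v w : X}, PathClass (vertex (ripsComplex X q hq) v)
      (vertex (ripsComplex X q hq) w) → Prop := fun {v w} c =>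
    ∃ c' : PathClass (vertex (ripsComplex X p hp) v) (vertex (ripsComplex X p hp) w),
      Path.Homotopic.Quotient.map c' i = c
  have hedge : ∀ {v w : X} (h : Adjacent (ripsComplex X q hq) v w), Lifts (edge h) := by
    intro v w h
    let γ := geoPath hgeo v w
    have hγ : ∀ t, dist v (γ t) < q := fun t =>
      (dist_left_geoPath_le hgeo v w t).trans_lt h.dist_lt
    have step : ∀ s t, dist (γ t) (γ s) < p → Lifts (edge (ripsComplex_adjacent hq (hγ t))) →
        Lifts (edge (ripsComplex_adjacent hq (hγ s))) := by
      rintro s t hst ⟨c, hc⟩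
      refine ⟨c.trans (edge (ripsComplex_adjacent hp hst)), ?_⟩
      rw [PathClass.map_trans]
      have e := edge_map_inclusion (ripsComplex_faces_mono X hp hq hpq)
        (ripsComplex_adjacent hp hst) (ripsComplex_adjacent hq (hst.trans_le hpq))
      have e2 := ripsComplex_edge_trans hq (hγ t) (hst.trans_le hpq) (hγ s)
      rw [← e2, ← e, ← hc]
      rfl
    have main : Lifts (edge (ripsComplex_adjacent hq (hγ 1))) := by
      refine unitInterval_induction
        (P := fun t => Lifts (edge (ripsComplex_adjacent hq (hγ t)))) ?_ fun t => ?_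
      · have gen : ∀ {u : X} (e : u = v) (hu : dist v u < q),
            Lifts (edge (ripsComplex_adjacent hq hu)) := by
          intro u e hu
          subst e
          rw [edge_self]
          exact ⟨Path.Homotopic.Quotient.refl _, rfl⟩
        exact gen γ.source (hγ 0)
      · filter_upwards [γ.continuous.continuousAt.preimage_mem_nhds
          (Metric.ball_mem_nhds (γ t) hp)] with s hs
        have hs' : dist (γ s) (γ t) < p := hs
        exact ⟨step t s hs', step s t (by rwa [dist_comm])⟩
    have gen : ∀ {u : X} (_ : u = w) (hu : dist v u < q),
        Lifts (edge (ripsComplex_adjacent hq hu)) → Lifts (edge h) := by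
      intro u e hu hl
      subst e
      exact hl
    exact gen γ.target (hγ 1) main
  have hall : ∀ {v w : X} (c : PathClass (vertex (ripsComplex X q hq) v)
      (vertex (ripsComplex X q hq) w)), Lifts c := by
    intro v w c
    have hc := isEdgeChain c
    induction hc with
    | refl => exact ⟨Path.Homotopic.Quotient.refl _, rfl⟩
    | trans_edge c _ e ih =>
      obtain ⟨c', hc'⟩ := ih
      obtain ⟨d', hd'⟩ := hedge e
      refine ⟨c'.trans d', ?_⟩
      rw [PathClass.map_trans, ← hc', ← hd']
      rfl
  intro a
  obtain ⟨c, hc⟩ := hall (FundamentalGroup.toPath a)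
  exact ⟨FundamentalGroup.fromPath c, (ripsPi1Map_apply x₀ hp hq hpq _).trans hc⟩

/-- The action at scale p, evaluated on geodesics, extends to a functor on the complex at scale q;
restricted to scale p it is the faithful action on the Rips group. A class that dies at scale q
therefore acts trivially, so it was trivial already. -/
theorem ripsPi1Map_injective {p q : ℝ} (hp : 0 < p) (hq : 0 < q) (hpq : p ≤ q)
    (h : ∀ {x : X} {c : PathClass x x} {L : ℝ}, HasLength c L → L < 3 * q →
      ripsTheta hp hgeo x₀ c = 1) :
    Function.Injective (ripsPi1Map x₀ p q hp hq hpq) := by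
  obtain ⟨Φ, hΦ⟩ := exists_pathHom_of_cocycle (K := ripsComplex X q hq)
    (fun x y => ripsTheta hp hgeo x₀ (geoClass hgeo x y)) (by
      intro σ u v w hu hv hw
      have h1 := dist_lt_of_mem_face σ hu hv
      have h2 := dist_lt_of_mem_face σ hv hw
      have h3 := dist_lt_of_mem_face σ hu hw
      -- The cocycle identity for a simplex: its geodesic triangle has perimeter below 3q.
      have := h (((hasLength_geoClass hgeo u v).trans (hasLength_geoClass hgeo v w)).trans
        (hasLength_geoClass hgeo u w).symm) (by linarith)
      rw [PathHom.map_trans, PathHom.map_symm, inv_mul_eq_one, PathHom.map_trans] at this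
      exact this.symm)
  have hagree : ∀ {v w : X} (c : PathClass (vertex (ripsComplex X p hp) v)
      (vertex (ripsComplex X p hp) w)),
      Φ.precomp (inclusion (ripsComplex_faces_mono X hp hq hpq)) c = ripsPerm hp hgeo x₀ c := by
    refine fun c => eq_of_eq_on_edges (fun {v w} e => ?_) c
    have hlt := e.dist_lt
    have e1 := edge_map_inclusion (ripsComplex_faces_mono X hp hq hpq) e
      (ripsComplex_adjacent hq (hlt.trans_le hpq))
    have e2 : Φ.precomp (inclusion (ripsComplex_faces_mono X hp hq hpq)) (edge e) =
        Φ (edge (ripsComplex_adjacent hq (hlt.trans_le hpq))) := congrArg Φ.toFun e1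
    rw [e2, hΦ, ripsTheta_of_hasLength hp hgeo x₀ (hasLength_geoClass hgeo v w) hlt,
      ripsCocycle_of_lt hp hgeo x₀ hlt]
  rw [injective_iff_map_eq_one]
  intro a ha
  rw [ripsPi1Map_apply] at ha
  have h1 := hagree (FundamentalGroup.toPath a)
  have h2 : Φ.precomp (inclusion (ripsComplex_faces_mono X hp hq hpq))
      (FundamentalGroup.toPath a) = 1 := (congrArg Φ.toFun ha).trans (Φ.map_refl _)
  rw [h2] at h1
  exact (ripsPerm_eq_one_iff hp hgeo x₀ _).1 h1.symm

/-- Injectivity must fail, so some loop shorter than 3q acts non-trivially at scale p, and it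
shrinks to a geodesic circle. Circles shorter than 3p act trivially, whence the lower bound. -/
theorem IsSmallRadius.exists_circle_of_not_bijective [CompactSpace X] {R : ℝ}
    (hR : IsSmallRadius X R) {p q : ℝ} (hp : 0 < p) (hq : 0 < q)
    (hpq : p ≤ q) (h : ¬ Function.Bijective (ripsPi1Map x₀ p q hp hq hpq)) :
    ∃ (l : ℝ) (c : C(UnitAddCircle, X)), IsGeodesicCircle l c ∧ 3 * p ≤ l ∧ l < 3 * q ∧
      ripsTheta hp hgeo x₀ (Path.Homotopic.Quotient.mk (circleLoop c)) ≠ 1 := by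
  by_contra hcon
  push Not at hcon
  refine h ⟨ripsPi1Map_injective hgeo x₀ hp hq hpq fun {x c L} hL hlt => ?_,
    ripsPi1Map_surjective hgeo x₀ hp hq hpq⟩
  by_contra hne
  obtain ⟨l, c, hc, hl, hne⟩ := hR.exists_isGeodesicCircle hgeo _ hL hne
  refine hne (hcon l c hc ?_ (hl.trans_lt hlt))
  by_contra hlp
  exact hne (ripsTheta_eq_one hp hgeo x₀ (hasLength_circleLoop hc) (not_le.1 hlp))

end Rips

/-! ### Critical values as lengths of geodesic circles. -/

section CriticalValues

open Filter

variable {X : Type*} [MetricSpace X]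

theorem IsGeodesicCircle.hasLipschitzConst [CompactSpace X] {l : ℝ} {c : C(UnitAddCircle, X)}
    (h : IsGeodesicCircle l c) :
    HasLipschitzConst (2 * Metric.diam (Set.univ : Set X)) c := fun s t => by
  rw [h.2]
  exact mul_le_mul_of_nonneg_right h.length_le dist_nonneg

/-- Geodesic circles whose lengths converge to `L > 0` subconverge to a geodesic circle. -/
theorem IsGeodesicCircle.exists_subseq_tendsto [CompactSpace X] {l : ℕ → ℝ}
    {c : ℕ → C(UnitAddCircle, X)} (h : ∀ n, IsGeodesicCircle (l n) (c n)) {L : ℝ} (hL : 0 < L)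
    (hl : Tendsto l atTop (𝓝 L)) :
    ∃ (c' : C(UnitAddCircle, X)) (φ : ℕ → ℕ), IsGeodesicCircle L c' ∧
      Tendsto (c ∘ φ) atTop (𝓝 c') := by
  obtain ⟨c', -, φ, hφ, hc⟩ := (isCompact_setOf_hasLipschitzConst (X := X) (α := UnitAddCircle)
    (2 * Metric.diam (Set.univ : Set X))).tendsto_subseq fun n => (h n).hasLipschitzConst
  refine ⟨c', φ, ⟨hL, fun s t => ?_⟩, hc⟩
  have hev : ∀ s, Tendsto (fun n => c (φ n) s) atTop (𝓝 (c' s)) := fun s =>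
    ((continuous_eval_const s).tendsto c').comp hc
  refine tendsto_nhds_unique ((hev s).dist (hev t)) ?_
  simp_rw [fun n => (h (φ n)).2 s t]
  exact (hl.comp hφ.tendsto_atTop).mul_const _

variable (hgeo : IsGeodesicSpace X) (x₀ : X)

/-- The obstruction circles for q and q + 1 / (n + 1) all act non-trivially at the same scale q.
Their limit has length 3q and is freely homotopic to those close to it. -/
theorem IsSmallRadius.exists_circle_of_isRightCriticalValue [CompactSpace X] {R : ℝ}
    (hR : IsSmallRadius X R) {q : ℝ} (hq : 0 < q) (h : IsRightCriticalValue x₀ q) :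
    ∃ c : C(UnitAddCircle, X), IsGeodesicCircle (3 * q) c ∧
      ripsTheta hq hgeo x₀ (Path.Homotopic.Quotient.mk (circleLoop c)) ≠ 1 := by
  have hε : ∀ n : ℕ, (0 : ℝ) < 1 / ((n : ℝ) + 1) := fun n => Nat.one_div_pos_of_nat
  choose l c hc hle hlt hne using fun n : ℕ =>
    hR.exists_circle_of_not_bijective hgeo x₀ hq _ _ (h.2 _ (hε n))
  have hl : Tendsto l atTop (𝓝 (3 * q)) := by
    refine tendsto_of_tendsto_of_tendsto_of_le_of_le tendsto_const_nhds ?_ hle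
      fun n => (hlt n).le
    simpa using (tendsto_one_div_add_atTop_nhds_zero_nat (𝕜 := ℝ)).const_add q |>.const_mul 3
  obtain ⟨c', φ, hc', hlim⟩ := IsGeodesicCircle.exists_subseq_tendsto hc (by positivity) hl
  obtain ⟨n, hn⟩ := (hlim.eventually (Metric.ball_mem_nhds c' (half_pos hR.1))).exists
  exact ⟨c', hc', fun h1 => hne (φ n)
    (((ripsTheta hq hgeo x₀).map_circleLoop_eq_one_iff (hR.homotopic_of_close hgeo hn)).2 h1)⟩

/-- The obstruction circles are all strictly shorter than 3q and fall into finitely many free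
homotopy classes. A circle of an infinitely repeated class acts trivially once the scale has passed
a third of its length, in contradiction with the later members of that class. -/
theorem IsSmallRadius.not_isLeftCriticalValue [CompactSpace X] {R : ℝ}
    (hR : IsSmallRadius X R) (hgeo : IsGeodesicSpace X) (x₀ : X) (q : ℝ) :
    ¬ IsLeftCriticalValue x₀ q := by
  rintro ⟨hq, ε₀, hε₀, h⟩
  set δ := min ε₀ q with hδ
  have hδ0 : 0 < δ := lt_min hε₀ hq
  have hn0 : ∀ n : ℕ, (0 : ℝ) < (n : ℝ) + 2 := fun n => by positivity
  -- The denominator n + 2 keeps the step strictly below both ε₀ and q, already for n = 0.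
  have hε : ∀ n : ℕ, 0 < δ / ((n : ℝ) + 2) := fun n => div_pos hδ0 (hn0 n)
  have hεδ : ∀ n : ℕ, δ / ((n : ℝ) + 2) < δ := fun n =>
    div_lt_self hδ0 (by linarith [n.cast_nonneg (α := ℝ)])
  have hpos : ∀ n : ℕ, 0 < q - δ / ((n : ℝ) + 2) := fun n => by
    linarith [hεδ n, min_le_right ε₀ q]
  choose l c hc hle hlt hne using fun n : ℕ =>
    hR.exists_circle_of_not_bijective hgeo x₀ _ _ _
      (h _ (hε n) ((hεδ n).trans_le (min_le_left _ _)) (hpos n))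
  have hfin := (hR.finite_freeHomotopyClass hgeo).to_subtype
  obtain ⟨C, hC⟩ := Finite.exists_infinite_fiber
    (fun n : ℕ => (⟨freeHomotopyClass (c n), l n, c n, hc n, rfl⟩ :
      {C | ∃ (l : ℝ) (c : C(UnitAddCircle, X)), IsGeodesicCircle l c ∧ freeHomotopyClass c = C}))
  have hC := Set.infinite_coe_iff.1 hC
  obtain ⟨n, hn⟩ := hC.nonempty
  have hlim : Tendsto (fun m : ℕ => 3 * (q - δ / ((m : ℝ) + 2))) atTop (𝓝 (3 * q)) := by
    have : Tendsto (fun m : ℕ => δ / ((m : ℝ) + 2)) atTop (𝓝 0) :=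
      tendsto_const_nhds.div_atTop
        (tendsto_atTop_add_const_right _ _ tendsto_natCast_atTop_atTop)
    simpa using (this.const_sub q).const_mul 3
  obtain ⟨N, hN⟩ := eventually_atTop.1 (hlim.eventually (lt_mem_nhds (hlt n)))
  -- An index of the same class, so late that its scale exceeds a third of the length of the n-th
  -- circle.
  obtain ⟨m, hm, hNm⟩ := hC.exists_gt N
  have hhom : (c m).Homotopic (c n) :=
    Quotient.exact (congrArg Subtype.val (Eq.trans hm (Eq.symm hn)))
  exact hne m (((ripsTheta (hpos m) hgeo x₀).map_circleLoop_eq_one_iff hhom).2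
    (ripsTheta_eq_one (hpos m) hgeo x₀ (hasLength_circleLoop (hc n)) (hN m hNm.le)))

theorem IsCriticalValue.pos {q : ℝ} (h : IsCriticalValue x₀ q) : 0 < q :=
  h.elim (fun h => h.1) fun h => h.1

theorem IsSmallRadius.exists_circle_of_isCriticalValue [CompactSpace X] {R : ℝ}
    (hR : IsSmallRadius X R) {q : ℝ} (hq : 0 < q) (h : IsCriticalValue x₀ q) :
    ∃ c : C(UnitAddCircle, X), IsGeodesicCircle (3 * q) c ∧
      ripsTheta hq hgeo x₀ (Path.Homotopic.Quotient.mk (circleLoop c)) ≠ 1 :=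
  h.elim (fun h => absurd h (hR.not_isLeftCriticalValue hgeo x₀ q))
    (hR.exists_circle_of_isRightCriticalValue hgeo x₀ hq)

theorem IsSmallRadius.finite_isCriticalValue [CompactSpace X] {R : ℝ}
    (hR : IsSmallRadius X R) (hgeo : IsGeodesicSpace X) (x₀ : X) :
    {q : ℝ | IsCriticalValue x₀ q}.Finite := by
  choose c hc hne using fun q : {q : ℝ | IsCriticalValue x₀ q} =>
    hR.exists_circle_of_isCriticalValue hgeo x₀ (IsCriticalValue.pos x₀ q.2) q.2
  -- At scale q' the circle of length 3q acts trivially and the one of length 3q' does not.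
  have hlt : ∀ q q' : {q : ℝ | IsCriticalValue x₀ q}, q < q' →
      freeHomotopyClass (c q) ≠ freeHomotopyClass (c q') := fun q q' hqq' heq =>
    hne q' (((ripsTheta _ hgeo x₀).map_circleLoop_eq_one_iff (Quotient.exact heq)).1
      (ripsTheta_eq_one _ hgeo x₀ (hasLength_circleLoop (hc q))
        (mul_lt_mul_of_pos_left hqq' three_pos)))
  have hinj : Function.Injective fun q => freeHomotopyClass (c q) := by
    intro q q' h
    by_contra hqq'
    exact (lt_or_gt_of_ne hqq').elim (fun h' => hlt _ _ h' h) fun h' => hlt _ _ h' h.symm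
  have hfin := (hR.finite_freeHomotopyClass hgeo).subset
    (Set.range_subset_iff.2 fun q => ⟨_, c q, hc q, rfl⟩)
  have := hfin.to_subtype
  exact Set.finite_coe_iff.1 (Finite.of_injective _ (Set.rangeFactorization_injective.2 hinj))

end CriticalValues

theorem mainTheorem4 {X : Type*} [MetricSpace X] [CompactSpace X]
    (hgeo : IsGeodesicSpace X) (hslsc : IsSLSC X) (x₀ : X) :
    {q : ℝ | IsCriticalValue x₀ q}.Finite ∧
    (∃ S : Set (FundamentalGroup X x₀),
      S.Finite ∧ S ⊆ geodesicLassoClasses x₀ ∧ Subgroup.closure S = ⊤) ∧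
    (∀ q : ℝ, IsCriticalValue x₀ q →
      {C | ∃ c : C(UnitAddCircle, X),
        IsGeodesicCircle (3 * q) c ∧ freeHomotopyClass c = C}.Finite ∧
      ∃ c : C(UnitAddCircle, X), IsGeodesicCircle (3 * q) c) ∧
    {C | ∃ (l : ℝ) (c : C(UnitAddCircle, X)),
      IsGeodesicCircle l c ∧ freeHomotopyClass c = C}.Finite := by
  obtain ⟨R, hR⟩ := exists_isSmallRadius hgeo hslsc
  have := hslsc.1
  have hfin := hR.finite_freeHomotopyClass hgeo
  refine ⟨hR.finite_isCriticalValue hgeo x₀, ?_, fun q hq => ⟨hfin.subset ?_, ?_⟩, hfin⟩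
  -- Each of the finitely many bounded-length generators is a word in finitely many lassos.
  · obtain ⟨T, hTS, hT, hTtop⟩ := Subgroup.exists_finite_subset_closure_eq_top
      (G := FundamentalGroup X x₀)
      (hR.finite_hasLength hgeo x₀ x₀ _) (hR.closure_hasLength hgeo x₀)
      (hR.closure_geodesicLassoClasses hgeo x₀)
    exact ⟨T, hT, hTS, hTtop⟩
  · rintro C ⟨c, hc, rfl⟩
    exact ⟨_, c, hc, rfl⟩
  · obtain ⟨c, hc, -⟩ := hR.exists_circle_of_isCriticalValue hgeo x₀ (IsCriticalValue.pos x₀ hq) hq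
    exact ⟨c, hc⟩
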